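/- Let $A$ be a finite alphabet, $A^+$ the free semigroup on $A$. An $A$-semigroup is a semigroup $S$ with a surjective homomorphism $\varphi\colon A^+\to S$; an $A$-morphism is a homomorphism compatible with the maps from $A^+$. The Mal'cev kernel of a homomorphism $\psi\colon M\to N$ is the family of subsemigroups $\psi^{-1}(e)$, $e$ an idempotent of $N$. For a variety $\mathcal V$ of semigroups, the Mal'cev expansion $S^{\mathcal V}$ is the $A$-semigroup $A^+/{\sim}$, where $\sim$ is the intersection of the congruences of all $A$-semigroups $T$ that admit an $A$-morphism $T\to S$ with Mal'cev kernel in $\mathcal V$; write $S^{\mathcal U.\mathcal V}=(S^{\mathcal U})^{\mathcal V}$. Let $\mathbf{RB}$ be the variety of rectangular bands ($x^2=x$, $xzy=xwy$) and, for a prime $p$, $\mathbf{Z}_p$ the variety of elementary abelian $p$-groups ($xy=yx$, $x^p=1$, that is $x^py=y$). For $t$ in a semigroup $T$, the right stabilizer of $t$ is $T_t=\{s\in T : ts=t\}$. In a semigroup $M$, $a\le_{\mathscr L}b$ means $a=b$ or $a\in Mb$, and $a\le_{\mathscr R}b$ means $a=b$ or $a\in bM$. **Theorem (Improved stabilizers).**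 There is a function $N\colon\mathbb N\to\mathbb N$ such that for every finite alphabet $A$, every finite $A$-semigroup $S$ and every prime $p\ge N(|S^{\mathbf{RB}}|)$, the semigroup $T=S^{\mathbf{RB}.\mathbf{Z}_p.\mathbf{RB}}$ has the following properties for every $t\in T$. 1. The right stabilizer $T_t$ is an $\mathscr R$-trivial (also called left regular) band; in particular it satisfies $x^2=x$ and $xyx=xy$. 2. $T_t$ is a chain under its own $\mathscr L$-order: for all $r,s\in T_t$, $r\ge_{\mathscr L}s$ or $s\ge_{\mathscr L}r$, where $\ge_{\mathscr L}$ is computed in $T_t$ rather than in $T$. 3. If $r,s\in T_t$ and $r\ge_{\mathscr L}s$ in $T_t$, then $sr=s$. 4. Each $\mathscr L$-class of $T_t$ is a left zero semigroup, that is, a subsemigroup satisfying $xy=x$. -/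

import Mathlib

namespace SgpExpansion

universe u v w

/-- A semigroup identity `ℓ = r` in the variables `0, 1, 2, …`, as a pair of words. -/
abbrev Identity : Type := FreeSemigroup ℕ × FreeSemigroup ℕ

/-- A variety of semigroups, given by a defining set of identities. -/
abbrev Variety : Type := Set Identity

/-- The semigroup `M` belongs to the variety defined by `V`: each identity of `V` holds under
every substitution of elements of `M` for the variables. -/
def Variety.Mem (V : Variety) (M : Type u) [Semigroup M] : Prop :=
  ∀ i ∈ V, ∀ σ : ℕ → M, FreeSemigroup.lift σ i.1 = FreeSemigroup.lift σ i.2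

/-- The variable `n`, as a word. -/
abbrev X (n : ℕ) : FreeSemigroup ℕ := FreeSemigroup.of n

/-- Rectangular bands: `x x = x` and `x z y = x w y`. -/
def RB : Variety :=
  {(X 0 * X 0, X 0), (X 0 * X 2 * X 1, X 0 * X 3 * X 1)}

/-- Elementary abelian `p`-groups (vector spaces over `ℤ/p`), as a variety of semigroups:
`x y = y x` and `x ^ p = 1`, the latter in the form `x ^ p y = y`. -/
def Zp (p : ℕ) : Variety :=
  {(X 0 * X 1, X 1 * X 0), ((fun z => X 0 * z)^[p] (X 1), X 1)}

/-- The inverse image of an idempotent under a morphism, as a subsemigroup. -/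
def fiber {M : Type u} {N : Type v} [Semigroup M] [Semigroup N] (ψ : M →ₙ* N) (e : N)
    (he : IsIdempotentElem e) : Subsemigroup M where
  carrier := {x | ψ x = e}
  mul_mem' := by
    intro a b ha hb
    have ha' : ψ a = e := ha
    have hb' : ψ b = e := hb
    show ψ (a * b) = e
    rw [map_mul, ha', hb']
    exact he

/-- The Mal'cev kernel of `ψ` lies in the variety `V`. -/
def MalcevKernelIn (V : Variety) {M : Type u} {N : Type v} [Semigroup M] [Semigroup N]
    (ψ : M →ₙ* N) : Prop :=
  ∀ (e : N) (he : IsIdempotentElem e), V.Mem (fiber ψ e he)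

section Expansion

variable {A : Type u} {S : Type v} [Semigroup S]

/-- Let `φ : A⁺ → S` make `S` an `A`-semigroup. This is the intersection of the congruences `c`
on `A⁺` for which there is an `A`-morphism `A⁺/c → S` with Mal'cev kernel in `V`. (Each
`A`-semigroup is, up to isomorphism of `A`-semigroups, of the form `A⁺/c`.) -/
def malcevCon (V : Variety) (φ : FreeSemigroup A →ₙ* S) : Con (FreeSemigroup A) :=
  sInf {c | ∃ ψ : c.Quotient →ₙ* S,
    (∀ x : FreeSemigroup A, ψ (x : c.Quotient) = φ x) ∧ MalcevKernelIn V ψ}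

/-- The Mal'cev expansion `S^V` of the `A`-semigroup `(S, φ)` by the variety `V`. -/
abbrev MalcevExpansion (V : Variety) (φ : FreeSemigroup A →ₙ* S) : Type u :=
  (malcevCon V φ).Quotient

/-- The canonical morphism `A⁺ → S^V`, which makes `S^V` an `A`-semigroup. -/
def toExpansion (V : Variety) (φ : FreeSemigroup A →ₙ* S) :
    FreeSemigroup A →ₙ* MalcevExpansion V φ where
  toFun x := (x : (malcevCon V φ).Quotient)
  map_mul' _ _ := rfl

end Expansion

section Green

variable {M : Type u} [Semigroup M]

/-- `a ≤ b` in the `L`-order of `M`: `a ∈ M¹ b`. -/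
def LLe (a b : M) : Prop := a = b ∨ ∃ x : M, a = x * b

/-- `a ≤ b` in the `R`-order of `M`: `a ∈ b M¹`. -/
def RLe (a b : M) : Prop := a = b ∨ ∃ x : M, a = b * x

/-- The `L`-class of `a` in `M`. -/
def lClass (a : M) : Set M := {b | LLe a b ∧ LLe b a}

/-- `M` is `R`-trivial: `R`-equivalent elements are equal. -/
def RTrivial (M : Type u) [Semigroup M] : Prop :=
  ∀ a b : M, RLe a b → RLe b a → a = b

/-- The right stabilizer `{s | t s = t}` of `t`. -/
def rightStabilizer (t : M) : Subsemigroup M where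
  carrier := {s | t * s = t}
  mul_mem' := by
    intro a b ha hb
    have ha' : t * a = t := ha
    have hb' : t * b = t := hb
    show t * (a * b) = t
    rw [← mul_assoc, ha', hb']

end Green

end SgpExpansion

/-! Write S₁ = S^RB, S₂ = S₁^Zp and T = S₂^RB. The congruence of an expansion is generated by the
instances of the identities over idempotents (`malcevCon_iff`), so an invariant of words need only
be checked on these.

Over a rectangular band u z u = u, so a factor that an identity inserts or deletes returns to where
it began. Hence the letters at which suffix values descend strictly in the L-order, or prefix values
in the R-order, are invariants of S₁ and T (`lCrossInv_RB`, `rCrossInv_RB`). The L-version makes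
elements with a common L-lower bound comparable (`leL_total`) and keeps subgroup elements other than
the identity out of right stabilizers (`eq_one_of_mem_stabilizer`).

Let w u = w in T. Powers of u reach a subgroup of T, so they are eventually constant in T, hence in
S₂ and S₁; let e be the idempotent power of u in S₁. The Z_p-expansion preserves modulo p the number
of passes of a path through an edge of the right Cayley graph of S₁, apart from edges translated
from R-classes not J-below e (`passes_eq_of_conGen`). Comparing two consecutive powers of u shows
that the loop u at e passes every other edge a multiple of p times. An edge that is passed at all is
then passed at least p times, and Ramsey's theorem finds a factor with idempotent value among the
returns (`exists_factor_of_passes`). L-comparability extends this to translated edges and lets a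
single factor serve all edges; the loop then lifts to one R-class and its value in S₁ is idempotent
(`mul_self_of_passes`). Now x^p y = y makes u idempotent in S₂, and x² = x makes it idempotent in T
(`mul_self_of_mem_stabilizer`). So a right stabilizer is a band, L-comparability makes it a chain,
and the remaining claims are formal. -/

namespace SgpExpansion

/-! ### Strict descents along words, and comparability in the L-order. -/

section Words

variable {A : Type*} {M : Type*} [Monoid M]

/-- The value of a word under a map of the letters into a monoid. -/
def ev (g : A → M) (w : List A) : M := (w.map g).prod

@[simp] lemma ev_nil (g : A → M) : ev g [] = 1 := rfl

@[simp] lemma ev_cons (g : A → M) (a : A) (w : List A) : ev g (a :: w) = g a * ev g w := by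
  simp [ev]

@[simp] lemma ev_append (g : A → M) (v w : List A) : ev g (v ++ w) = ev g v * ev g w := by
  simp [ev]

/-- `a ≤ b` in the `L`-order of a monoid. -/
def LeL (a b : M) : Prop := ∃ m, a = m * b

/-- `a ≤ b` in the `R`-order of a monoid. -/
def LeR (a b : M) : Prop := ∃ m, a = b * m

/-- `a ≤ b` in the `J`-order of a monoid. -/
def LeJ (a b : M) : Prop := ∃ m n, a = m * b * n

lemma LeR.refl (a : M) : LeR a a := ⟨1, by simp⟩

lemma LeL.trans {a b c : M} (h : LeL a b) (h' : LeL b c) : LeL a c := by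
  obtain ⟨m, rfl⟩ := h
  obtain ⟨n, rfl⟩ := h'
  exact ⟨m * n, by simp [mul_assoc]⟩

lemma LeR.trans {a b c : M} (h : LeR a b) (h' : LeR b c) : LeR a c := by
  obtain ⟨m, rfl⟩ := h
  obtain ⟨n, rfl⟩ := h'
  exact ⟨n * m, by simp [mul_assoc]⟩

lemma LeJ.refl (a : M) : LeJ a a := ⟨1, 1, by simp⟩

lemma LeJ.trans {a b c : M} (h : LeJ a b) (h' : LeJ b c) : LeJ a c := by
  obtain ⟨m, n, rfl⟩ := h
  obtain ⟨k, l, rfl⟩ := h'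
  exact ⟨m * k, l * n, by simp [mul_assoc]⟩

lemma LeL.leJ {a b : M} (h : LeL a b) : LeJ a b := by
  obtain ⟨m, rfl⟩ := h
  exact ⟨m, 1, by simp⟩

lemma LeR.leJ {a b : M} (h : LeR a b) : LeJ a b := by
  obtain ⟨m, rfl⟩ := h
  exact ⟨1, m, by simp⟩

lemma LeL.mul_left (a b : M) : LeL (a * b) b := ⟨a, rfl⟩

lemma LeR.mul_right (a b : M) : LeR (a * b) a := ⟨b, rfl⟩

/-- Some factorization `w = z b v` of the word `w` reads the letter `b` from the right at the
value `s`, when the reading starts at `β`. -/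
def OccL (g : A → M) (w : List A) (β : M) (b : A) (s : M) : Prop :=
  ∃ z v, w = z ++ b :: v ∧ ev g v * β = s

/-- Some factorization `w = v b z` of the word `w` reads the letter `b` from the left at the
value `s`, when the reading starts at `α`. -/
def OccR (g : A → M) (w : List A) (α : M) (b : A) (s : M) : Prop :=
  ∃ v z, w = v ++ b :: z ∧ α * ev g v = s

/-- The letters at which the value of a suffix descends strictly in the `L`-order, and the values
at which they are read, depend on the value of the word only. -/
def LCrossInv (g : A → M) : Prop :=
  ∀ w w', ev g w = ev g w' → ∀ b s, ¬ LeL s (g b * s) → OccL g w 1 b s → OccL g w' 1 b s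

/-- The letters at which the value of a prefix descends strictly in the `R`-order, and the values
at which they are read, depend on the value of the word only. -/
def RCrossInv (g : A → M) : Prop :=
  ∀ w w', ev g w = ev g w' → ∀ b s, ¬ LeR s (s * g b) → OccR g w 1 b s → OccR g w' 1 b s

lemma occL_append (g : A → M) (w₁ w₂ : List A) (β : M) (b : A) (s : M) :
    OccL g (w₁ ++ w₂) β b s ↔ OccL g w₂ β b s ∨ OccL g w₁ (ev g w₂ * β) b s := by
  constructor
  · rintro ⟨z, v, h, rfl⟩
    rcases List.append_eq_append_iff.1 h with ⟨c, rfl, hc⟩ | ⟨c, rfl, hc⟩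
    · exact Or.inl ⟨c, v, hc, rfl⟩
    · cases c with
      | nil => exact Or.inl ⟨[], v, by simpa using hc.symm, rfl⟩
      | cons d c =>
        simp only [List.cons_append, List.cons.injEq] at hc
        obtain ⟨rfl, rfl⟩ := hc
        exact Or.inr ⟨z, c, rfl, by simp [mul_assoc]⟩
  · rintro (⟨z, v, rfl, rfl⟩ | ⟨z, v, rfl, rfl⟩)
    · exact ⟨w₁ ++ z, v, by simp, rfl⟩
    · exact ⟨z, v ++ w₂, by simp, by simp [mul_assoc]⟩

lemma occR_append (g : A → M) (w₁ w₂ : List A) (α : M) (b : A) (s : M) :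
    OccR g (w₁ ++ w₂) α b s ↔ OccR g w₁ α b s ∨ OccR g w₂ (α * ev g w₁) b s := by
  constructor
  · rintro ⟨v, z, h, rfl⟩
    rcases List.append_eq_append_iff.1 h with ⟨c, rfl, hc⟩ | ⟨c, rfl, hc⟩
    · exact Or.inr ⟨c, z, hc, by simp [mul_assoc]⟩
    · cases c with
      | nil => exact Or.inr ⟨[], z, by simpa using hc.symm, by simp⟩
      | cons d c =>
        simp only [List.cons_append, List.cons.injEq] at hc
        obtain ⟨rfl, rfl⟩ := hc
        exact Or.inl ⟨v, c, rfl, rfl⟩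
  · rintro (⟨v, z, rfl, rfl⟩ | ⟨v, z, rfl, rfl⟩)
    · exact ⟨v, z ++ w₂, by simp, rfl⟩
    · exact ⟨w₁ ++ v, z, by simp, by simp [mul_assoc]⟩

/-- A path whose end is L-above its start cannot descend strictly on the way: the rest of the path
and the return lead back to s. -/
lemma OccL.leL_of_return {g : A → M} {w : List A} {β s : M} {b : A} (h : OccL g w β b s)
    (hβ : LeL β (ev g w * β)) : LeL s (g b * s) := by
  obtain ⟨z, v, rfl, rfl⟩ := h
  obtain ⟨m, hm⟩ := hβ
  refine ⟨ev g v * m * ev g z, ?_⟩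
  conv_lhs => rw [hm]
  simp [mul_assoc]

lemma OccR.leR_of_return {g : A → M} {w : List A} {α s : M} {b : A} (h : OccR g w α b s)
    (hα : LeR α (α * ev g w)) : LeR s (s * g b) := by
  obtain ⟨v, z, rfl, rfl⟩ := h
  obtain ⟨m, hm⟩ := hα
  refine ⟨ev g z * m * ev g v, ?_⟩
  conv_lhs => rw [hm]
  simp [mul_assoc]

/-- The letter at which the suffixes of `w` first leave the elements `≥ r` in the `L`-order. -/
lemma exists_last_leL (g : A → M) (r : M) (w : List A) :
    LeL r (ev g w) ∨ ∃ z b v, w = z ++ b :: v ∧ LeL r (ev g v) ∧ ¬ LeL r (g b * ev g v) := by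
  induction w with
  | nil => exact Or.inl ⟨r, by simp⟩
  | cons a w ih =>
    rcases ih with h | ⟨z, b, v, rfl, h⟩
    · by_cases ha : LeL r (ev g (a :: w))
      · exact Or.inl ha
      · exact Or.inr ⟨[], a, w, rfl, h, by simpa using ha⟩
    · exact Or.inr ⟨a :: z, b, v, rfl, h⟩

/-- Two elements with a common lower bound in the `L`-order are comparable. -/
theorem leL_total {g : A → M} (hg : ∀ m, ∃ w, ev g w = m) (hL : LCrossInv g) {t r s : M}
    (hr : LeL t r) (hs : LeL t s) : LeL r s ∨ LeL s r := by
  obtain ⟨z, rfl⟩ := hr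
  obtain ⟨z', h⟩ := hs
  obtain ⟨Z, rfl⟩ := hg z
  obtain ⟨Z', rfl⟩ := hg z'
  obtain ⟨R, rfl⟩ := hg r
  obtain ⟨S, rfl⟩ := hg s
  rcases exists_last_leL g (ev g R) S with h1 | ⟨y, b, v, rfl, hv, hb⟩
  · exact Or.inl h1
  · right
    -- This descent occurs in Z'S, hence in ZR. Inside R it would put r below b v; so R is read
    -- before it, and s ≤ v ≤ r.
    have hdesc : ¬ LeL (ev g v) (g b * ev g v) := fun hh => hb (hv.trans hh)
    obtain ⟨y', v', hy, hv'⟩ := hL (Z' ++ (y ++ b :: v)) (Z ++ R) (by simpa using h.symm) b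
      (ev g v) hdesc ⟨Z' ++ y, v, by simp, by simp⟩
    rw [mul_one] at hv'
    have hSv : LeL (ev g (y ++ b :: v)) (ev g v) := ⟨ev g y * g b, by simp [mul_assoc]⟩
    rcases List.append_eq_append_iff.1 hy with ⟨c, rfl, hc⟩ | ⟨c, rfl, hc⟩
    · exact absurd ⟨ev g c, by rw [hc, ← hv']; simp⟩ hb
    · cases c with
      | nil => exact absurd ⟨1, by rw [← hv']; simp at hc; simp [← hc]⟩ hb
      | cons d c =>
        simp only [List.cons_append, List.cons.injEq] at hc
        obtain ⟨rfl, rfl⟩ := hc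
        refine hSv.trans ⟨ev g c, ?_⟩
        rw [← hv']; simp

/-- A subgroup element that stabilizes some element is the identity of the subgroup. -/
theorem eq_one_of_mem_stabilizer {g : A → M} (hg : ∀ m, ∃ w, ev g w = m) (hL : LCrossInv g)
    {t h h' η : M} (ht : t * h = t) (h₁ : η * h = h) (h₂ : h * η = h) (h₃ : h * h' = η)
    (h₄ : h' * h = η) (h₅ : η * h' = h') : h = η := by
  have htη : t * η = t := by rw [← ht, mul_assoc, h₂]
  have hηη : η * η = η := by
    calc η * η = η * h * h' := by rw [mul_assoc, h₃]
      _ = η := by rw [h₁, h₃]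
  obtain ⟨w, rfl⟩ := hg t
  obtain ⟨G, rfl⟩ := hg h
  obtain ⟨N, rfl⟩ := hg η
  rcases exists_last_leL g (ev g N) w with ⟨k, hk⟩ | ⟨z, b, s, rfl, ⟨m, hm⟩, hb⟩
  · calc ev g G = ev g N * ev g G := h₁.symm
      _ = ev g N := by rw [hk, mul_assoc, ht]
  -- The descent must reappear in the words for t η and t h, but not inside N or G. Hence s η = s,
  -- and y h = s for some suffix y of t preceded by b. A y longer or shorter than s would put η
  -- below b s; so y = s and h = η h = m s h = m s = η.
  · have hdesc : ¬ LeL (ev g s) (g b * ev g s) := fun hh => hb (LeL.trans ⟨m, hm⟩ hh)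
    have hocc : OccL g (z ++ b :: s) 1 b (ev g s) := ⟨z, s, rfl, by simp⟩
    have hs : ev g s * ev g N = ev g s := by
      have h0 := hL _ ((z ++ b :: s) ++ N) (by rw [ev_append _ (z ++ b :: s) N, htη]) b _ hdesc hocc
      rw [occL_append] at h0
      rcases h0 with ⟨x, y, hxy, hy⟩ | ⟨x, y, hxy, hy⟩
      · refine absurd ⟨ev g x, ?_⟩ hb
        rw [mul_one] at hy
        rw [← hy, hxy]; simp
      · rw [mul_one] at hy
        rw [← hy, mul_assoc, hηη]
    have h0 := hL _ ((z ++ b :: s) ++ G) (by rw [ev_append _ (z ++ b :: s) G, ht]) b _ hdesc hocc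
    rw [occL_append] at h0
    rcases h0 with ⟨x, y, hxy, hy⟩ | ⟨x, y, hxy, hy⟩
    · refine absurd ⟨h' * ev g x, ?_⟩ hb
      rw [mul_one] at hy
      rw [← h₄, ← hy, hxy]; simp [mul_assoc]
    · rw [mul_one] at hy
      have key : ∀ x' : List A, y = x' ++ b :: s → False := by
        rintro x' rfl
        apply hb
        refine ⟨ev g G * m * ev g x', ?_⟩
        have e1 : ev g s * h' = ev g x' * (g b * ev g s) := by
          calc ev g s * h' = ev g (x' ++ b :: s) * ev g G * h' := by rw [hy]
            _ = ev g x' * (g b * (ev g s * ev g N)) := by rw [← h₃]; simp [mul_assoc]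
            _ = _ := by rw [hs]
        calc ev g N = ev g G * (ev g N * h') := by rw [h₅, h₃]
          _ = ev g G * (m * (ev g s * h')) := by conv_lhs => rw [hm, mul_assoc]
          _ = _ := by rw [e1]; simp [mul_assoc]
      rcases List.append_eq_append_iff.1 hxy with ⟨c, rfl, hc⟩ | ⟨c, rfl, hc⟩
      · cases c with
        | nil =>
          simp only [List.nil_append, List.cons.injEq, true_and] at hc
          subst hc
          calc ev g G = ev g N * ev g G := h₁.symm
            _ = ev g N := by rw [hm, mul_assoc, hy]
        | cons d c =>
          simp only [List.cons_append, List.cons.injEq] at hc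
          obtain ⟨rfl, rfl⟩ := hc
          exfalso
          apply hb
          have e2 : ev g N = m * ev g c * g b * ev g y := by rw [hm]; simp [mul_assoc]
          refine ⟨h' * (m * ev g c), ?_⟩
          rw [← h₄, ← h₁, e2, ← hy]; simp [mul_assoc]
      · cases c with
        | nil =>
          simp only [List.nil_append, List.cons.injEq, true_and] at hc
          subst hc
          calc ev g G = ev g N * ev g G := h₁.symm
            _ = ev g N := by rw [hm, mul_assoc, hy]
        | cons d c =>
          simp only [List.cons_append, List.cons.injEq] at hc
          exact (key c hc.2).elim

end Words

/-! ### Lifting loops of the right Cayley graph to the R-class of an idempotent. -/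

section FiniteMonoid

variable {A : Type*} {M : Type*} [Monoid M]

lemma exists_pow_mul_self [Finite M] (x : M) : ∃ n, 0 < n ∧ x ^ n * x ^ n = x ^ n := by
  obtain ⟨i, j, hij, h⟩ : ∃ i j : ℕ, i < j ∧ x ^ i = x ^ j := by
    obtain ⟨i, j, hne, h⟩ := Finite.exists_ne_map_eq_of_infinite (fun n : ℕ => x ^ n)
    rcases lt_or_gt_of_ne hne with hlt | hlt
    · exact ⟨i, j, hlt, h⟩
    · exact ⟨j, i, hlt, h.symm⟩
  obtain ⟨d, rfl⟩ := Nat.exists_eq_add_of_lt hij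
  have step : ∀ k m, i ≤ m → x ^ m = x ^ (m + k * (d + 1)) := by
    intro k
    induction k with
    | zero => intro m _; simp
    | succ k ih =>
      intro m hm
      obtain ⟨l, rfl⟩ := Nat.exists_eq_add_of_le hm
      calc x ^ (i + l) = x ^ (i + d + 1) * x ^ l := by rw [pow_add, h]
        _ = x ^ (i + l + (d + 1)) := by rw [← pow_add]; congr 1; omega
        _ = _ := by rw [ih _ (by omega)]; congr 1; ring
  refine ⟨(i + 1) * (d + 1), by positivity, ?_⟩
  rw [← pow_add, ← step (i + 1) _ (by nlinarith)]

/-- Stability of finite monoids: iterate b = x b (m y) until the power of m y is idempotent; this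
power then fixes b. -/
lemma LeR.symm_of_leJ [Finite M] {a b : M} (h : LeR a b) (h' : LeJ b a) : LeR b a := by
  obtain ⟨m, rfl⟩ := h
  obtain ⟨x, y, hb⟩ := h'
  have key : ∀ n : ℕ, b = x ^ n * b * (m * y) ^ n := by
    intro n
    induction n with
    | zero => simp
    | succ n ih =>
      calc b = x * (x ^ n * b * (m * y) ^ n) * (m * y) := by
            rw [← ih]; conv_lhs => rw [hb]
            simp [mul_assoc]
        _ = _ := by rw [pow_succ', pow_succ]; simp [mul_assoc]
  obtain ⟨n, hn, hid⟩ := exists_pow_mul_self (m * y)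
  have hb' : b * (m * y) ^ n = b := by
    conv_lhs => rw [key n, mul_assoc, hid, ← key n]
  obtain ⟨k, rfl⟩ := Nat.exists_eq_succ_of_ne_zero hn.ne'
  refine ⟨y * (m * y) ^ k, ?_⟩
  conv_lhs => rw [← hb', pow_succ']
  simp [mul_assoc]

lemma LeL.symm_of_leJ [Finite M] {a b : M} (h : LeL a b) (h' : LeJ b a) : LeL b a := by
  obtain ⟨m, rfl⟩ := h
  obtain ⟨x, y, hb⟩ := h'
  have key : ∀ n : ℕ, b = (x * m) ^ n * b * y ^ n := by
    intro n
    induction n with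
    | zero => simp
    | succ n ih =>
      calc b = (x * m) * ((x * m) ^ n * b * y ^ n) * y := by
            rw [← ih]; conv_lhs => rw [hb]
            simp [mul_assoc]
        _ = _ := by rw [pow_succ', pow_succ]; simp [mul_assoc]
  obtain ⟨n, hn, hid⟩ := exists_pow_mul_self (x * m)
  have hb' : (x * m) ^ n * b = b := by
    conv_lhs => rw [key n, ← mul_assoc, ← mul_assoc, hid, ← key n]
  obtain ⟨k, rfl⟩ := Nat.exists_eq_succ_of_ne_zero hn.ne'
  refine ⟨(x * m) ^ k * x, ?_⟩
  conv_lhs => rw [← hb', pow_succ]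
  simp [mul_assoc]

/-- Left translation by an element that the idempotent `f` stabilizes is injective on the
`R`-class of `f`. -/
lemma injOn_rClass [Finite M] {g : A → M} (hg : ∀ m, ∃ w, ev g w = m) (hL : LCrossInv g)
    {q f m m' : M} (hf : f * f = f) (hq : q * f = q) (h₁ : LeR m f) (h₂ : LeR f m)
    (h₁' : LeR m' f) (h₂' : LeR f m') (h : q * m = q * m') : m = m' := by
  have main : ∀ m m' : M, LeR m f → LeR f m → LeR m' f → LeR f m' → q * m = q * m' →
      LeL m m' → m = m' := by
    intro m m' h₁ h₂ h₁' h₂' h hle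
    have hle' : LeL m' m := hle.symm_of_leJ (h₁'.trans h₂).leJ
    have fm : f * m = m := by obtain ⟨x, rfl⟩ := h₁; rw [← mul_assoc, hf]
    have fm' : f * m' = m' := by obtain ⟨x, rfl⟩ := h₁'; rw [← mul_assoc, hf]
    -- m and m' are both L- and R-equivalent. With f = m n, the element m' n lies in the subgroup at
    -- f and stabilizes q, so it equals f.
    obtain ⟨n, hn⟩ := h₂
    obtain ⟨j, hj⟩ := hle'
    obtain ⟨k, hk⟩ := hle
    have e1 : m' * n = j * f := by rw [hj, mul_assoc, ← hn]
    have e2 : f = k * (m' * n) := by rw [hn, ← mul_assoc, ← hk]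
    have fh : f * (m' * n) = m' * n := by rw [← mul_assoc, fm']
    have hfh : m' * n * f = m' * n := by rw [e1, mul_assoc, hf]
    obtain ⟨i, hi⟩ : LeR f (m' * n) :=
      LeR.symm_of_leJ ((LeR.mul_right _ _).trans h₁') (LeL.leJ ⟨k, e2⟩)
    have inv : f * k * f = f * i * f := by
      calc f * k * f = f * k * (m' * n * i) := by rw [← hi]
        _ = f * (k * (m' * n)) * i := by simp [mul_assoc]
        _ = f * i := by rw [← e2, hf]
        _ = f * k * (m' * n) * i := by rw [mul_assoc f k, ← e2, hf]
        _ = f * k * (m' * n * f) * i := by rw [hfh]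
        _ = f * (k * (m' * n)) * (f * i) := by simp [mul_assoc]
        _ = f * (f * i) := by rw [← e2, hf]
        _ = f * i := by rw [← mul_assoc, hf]
        _ = f * i * f := by
          have : f * i = f * k * f := by
            calc f * i = f * (k * (m' * n)) * i := by rw [← e2, hf]
              _ = f * k * (m' * n * i) := by simp [mul_assoc]
              _ = f * k * f := by rw [← hi]
          rw [this, mul_assoc (f * k), hf]
    have hh : m' * n = f := by
      refine eq_one_of_mem_stabilizer hg hL (t := q) (h' := f * k * f) ?_ fh hfh ?_ ?_ ?_
      · rw [← mul_assoc, ← h, mul_assoc, ← hn, hq]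
      · rw [inv]
        calc m' * n * (f * i * f) = (m' * n * f) * i * f := by simp [mul_assoc]
          _ = f := by rw [hfh, ← hi, hf]
      · rw [mul_assoc, fh, mul_assoc, ← e2, hf]
      · simp only [← mul_assoc, hf]
    calc m = f * m := fm.symm
      _ = m' * n * m := by rw [hh]
      _ = j * (m * n) * m := by conv_lhs => rw [hj, mul_assoc j]
      _ = m' := by rw [← hn, mul_assoc, fm, ← hj]
  rcases leL_total hg hL (t := q * m) (LeL.mul_left q m) ⟨q, h⟩ with hle | hle
  · exact main m m' h₁ h₂ h₁' h₂' h hle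
  · exact (main m' m h₁' h₂' h₁ h₂ h.symm hle).symm

/-- The edge `y → y b` of the right Cayley graph is the image under left translation by `q` of an
edge inside the `R`-class of `f`. -/
def Absorbed (g : A → M) (q f y : M) (b : A) : Prop :=
  ∃ m, q * m = y ∧ LeR m f ∧ LeR f (m * g b)

/-- The word `u`, read from `e`, has a factor with idempotent value `f` that is read from `q` and
returns to `q`. -/
def IdemFactor (g : A → M) (u : List A) (e q f : M) : Prop :=
  ∃ u₁ F u₂, u = u₁ ++ F ++ u₂ ∧ e * ev g u₁ = q ∧ ev g F = f ∧ f * f = f ∧ q * f = q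

/-- With f = n k and f' = n' k', both k n and k' n' are L-above the common vertex y, hence
comparable. If k n is the lower one, left multiplication by n k' carries lifts over f' to lifts over
f. -/
lemma absorbed_merge {g : A → M} (hg : ∀ m, ∃ w, ev g w = m) (hL : LCrossInv g)
    {q f q' f' y n n' : M} (hf : f * f = f) (hq : q * f = q) (hf' : f' * f' = f')
    (hq' : q' * f' = q') (hn : q * n = y) (h₁ : LeR n f) (h₂ : LeR f n) (hn' : q' * n' = y)
    (h₁' : LeR n' f') (h₂' : LeR f' n') :
    (∀ z c, Absorbed g q' f' z c → Absorbed g q f z c) ∨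
      (∀ z c, Absorbed g q f z c → Absorbed g q' f' z c) := by
  have half : ∀ {q f q' f' y n n' k k' : M}, f * f = f → q * f = q → f' * f' = f' →
      q' * f' = q' → q * n = y → LeR n f → f = n * k → k * f = k → q' * n' = y → LeR n' f' →
      f' = n' * k' → k' * f' = k' → LeL (k * n) (k' * n') →
      ∀ z b, Absorbed g q' f' z b → Absorbed g q f z b := by
    rintro q f q' f' y n n' k k' hf hq hf' hq' hn h₁ hk hkf hn' h₁' hk' hkf' ⟨x, hx⟩ z b
      ⟨m, hm, hmf, l, hl⟩
    have fn : f * n = n := by obtain ⟨x, rfl⟩ := h₁; rw [← mul_assoc, hf]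
    have fn' : f' * n' = n' := by obtain ⟨x, rfl⟩ := h₁'; rw [← mul_assoc, hf']
    have fm : f' * m = m := by obtain ⟨x, rfl⟩ := hmf; rw [← mul_assoc, hf']
    have hkn : k' * n' * (k' * n') = k' * n' := by
      calc k' * n' * (k' * n') = k' * (n' * k') * n' := by simp [mul_assoc]
        _ = k' * n' := by rw [← hk', hkf']
    have hnb : n * (k' * n') = n := by
      calc n * (k' * n') = (n * k) * n * (k' * n') := by rw [← hk, fn]
        _ = n * (k * n) * (k' * n') := by simp [mul_assoc]
        _ = n * (k * n) := by rw [hx, mul_assoc, mul_assoc x, hkn]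
        _ = (n * k) * n := by simp [mul_assoc]
        _ = n := by rw [← hk, fn]
    refine ⟨n * k' * m, ?_, ?_, l * n' * k, ?_⟩
    · calc q * (n * k' * m) = (q * n) * k' * m := by simp [mul_assoc]
        _ = q' * (n' * k') * m := by rw [hn, ← hn']; simp [mul_assoc]
        _ = z := by rw [← hk', mul_assoc, fm, hm]
    · exact LeR.trans ⟨k' * m, by simp [mul_assoc]⟩ h₁
    · calc f = n * (k' * n') * k := by rw [hnb, hk]
        _ = n * k' * (f' * n') * k := by rw [fn']; simp [mul_assoc]
        _ = n * k' * m * g b * (l * n' * k) := by rw [hl]; simp [mul_assoc]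
  have inv : ∀ {f n : M}, f * f = f → LeR f n → ∃ k, f = n * k ∧ k * f = k := by
    rintro f n hf ⟨k, hk⟩
    exact ⟨k * f, by rw [← mul_assoc, ← hk, hf], by rw [mul_assoc, hf]⟩
  obtain ⟨k, hk, hkf⟩ := inv hf h₂
  obtain ⟨k', hk', hkf'⟩ := inv hf' h₂'
  have ha : LeL y (k * n) := ⟨y, by
    calc y = q * f * n := by rw [hq, hn]
      _ = y * (k * n) := by rw [← hn, hk]; simp [mul_assoc]⟩
  have hb : LeL y (k' * n') := ⟨y, by
    calc y = q' * f' * n' := by rw [hq', hn']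
      _ = y * (k' * n') := by rw [← hn', hk']; simp [mul_assoc]⟩
  rcases leL_total hg hL ha hb with h | h
  · exact Or.inl (half hf hq hf' hq' hn h₁ hk hkf hn' h₁' hk' hkf' h)
  · exact Or.inr (half hf' hq' hf hq hn' h₁' hk' hkf' hn h₁ hk hkf h)

/-- A path all of whose edges are absorbed lifts to the `R`-class of `f`. -/
lemma leR_mul_ev_of_absorbed [Finite M] {g : A → M} (hg : ∀ m, ∃ w, ev g w = m) (hL : LCrossInv g)
    {q f : M} (hf : f * f = f) (hq : q * f = q) (w : List A) :
    ∀ m, LeR m f → LeR f m → (∀ z b, OccR g w (q * m) b z → Absorbed g q f z b) →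
      LeR f (m * ev g w) := by
  induction w with
  | nil => intro m _ h₂ _; simpa using h₂
  | cons a w ih =>
    intro m h₁ h₂ h
    obtain ⟨m', hm', h₁', h₂'⟩ := h (q * m) a ⟨[], w, rfl, by simp⟩
    obtain rfl : m' = m := injOn_rClass hg hL hf hq h₁' (h₂'.trans (LeR.mul_right _ _)) h₁ h₂ hm'
    have := ih (m' * g a) ((LeR.mul_right _ _).trans h₁) h₂' ?_
    · simpa [mul_assoc] using this
    · rintro z b ⟨v, v', rfl, rfl⟩
      exact h _ b ⟨a :: v, v', rfl, by simp [mul_assoc]⟩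

/-- If one idempotent factor absorbs all edges of the loop `u` at `e`, then the value of `u` is
idempotent. -/
lemma mul_self_of_absorbed [Finite M] {g : A → M} (hg : ∀ m, ∃ w, ev g w = m) (hL : LCrossInv g)
    {u : List A} {e q f : M} (he : e * ev g u = e) (h : IdemFactor g u e q f)
    (habs : ∀ z b, OccR g u e b z → Absorbed g q f z b) : ev g u * ev g u = ev g u := by
  obtain ⟨u₁, F, u₂, rfl, hq, hF, hf, hqf⟩ := h
  have h2 : LeR f (f * ev g u₂) := by
    refine leR_mul_ev_of_absorbed hg hL hf hqf u₂ f (LeR.refl f) (LeR.refl f) ?_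
    intro z b hz
    apply habs
    rw [occR_append]
    right
    rwa [ev_append, ← mul_assoc, hq, hF]
  have hqe : q * (f * ev g u₂) = e := by
    conv_rhs => rw [← he]
    rw [ev_append, ev_append, hF, ← hq]
    simp [mul_assoc]
  have h1 : LeR f (f * ev g u₂ * ev g u₁) := by
    refine leR_mul_ev_of_absorbed hg hL hf hqf u₁ _ (LeR.mul_right _ _) h2 ?_
    intro z b hz
    apply habs
    rw [occR_append, occR_append]
    rw [hqe] at hz
    exact Or.inl (Or.inl hz)
  -- q sends both sides to q, so injectivity of the translation closes the lifted loop.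
  have hfix : f * ev g u₂ * ev g u₁ = f := by
    refine injOn_rClass hg hL hf hqf ?_ h1 (LeR.refl f) (LeR.refl f) ?_
    · rw [mul_assoc]; exact LeR.mul_right _ _
    · rw [← mul_assoc, hqe, hqf, hq]
  simp only [ev_append, hF]
  calc ev g u₁ * f * ev g u₂ * (ev g u₁ * f * ev g u₂)
      = ev g u₁ * (f * ev g u₂ * ev g u₁) * f * ev g u₂ := by simp [mul_assoc]
    _ = _ := by rw [hfix, mul_assoc (ev g u₁), hf]

/-- Induction on prefixes: the factor serving a prefix and the one serving the next edge both lift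
the vertex between them, so one of the two serves both. -/
lemma exists_absorbing_factor {g : A → M} (hg : ∀ m, ∃ w, ev g w = m) (hL : LCrossInv g)
    {u : List A} {e : M} (hu : u ≠ [])
    (h : ∀ z b, OccR g u e b z → ∃ q f, IdemFactor g u e q f ∧ Absorbed g q f z b) :
    ∃ q f, IdemFactor g u e q f ∧ ∀ z b, OccR g u e b z → Absorbed g q f z b := by
  have key : ∀ w w' : List A, w ++ w' = u → w ≠ [] →
      ∃ q f, IdemFactor g u e q f ∧ ∀ z b, OccR g w e b z → Absorbed g q f z b := by
    intro w
    induction w using List.reverseRecOn with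
    | nil => intro _ _ h; exact (h rfl).elim
    | append_singleton w a ih =>
      intro w' hw _
      obtain ⟨q, f, hF, hq⟩ := h (e * ev g w) a ⟨w, w', by simp [← hw], rfl⟩
      have single : ∀ z b, OccR g [a] (e * ev g w) b z → z = e * ev g w ∧ b = a := by
        rintro z b ⟨v, v', hv, rfl⟩
        cases v with
        | nil => simp at hv; simp [hv]
        | cons c v => simp at hv
      by_cases hwn : w = []
      · subst hwn
        refine ⟨q, f, hF, ?_⟩
        intro z b hz
        obtain ⟨rfl, rfl⟩ := single z b (by simpa using hz)
        exact hq
      · obtain ⟨q', f', hF', hq'⟩ := ih (a :: w') (by simp [← hw]) hwn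
        have hall : ∀ {q f}, Absorbed g q f (e * ev g w) a →
            (∀ z b, OccR g w e b z → Absorbed g q f z b) →
            ∀ z b, OccR g (w ++ [a]) e b z → Absorbed g q f z b := by
          intro q f h1 h2 z b hz
          rcases (occR_append _ _ _ _ _ _).1 hz with hz | hz
          · exact h2 z b hz
          · obtain ⟨rfl, rfl⟩ := single z b hz
            exact h1
        obtain ⟨m, hm, hm1, hm2⟩ := hq
        obtain ⟨v, c, rfl⟩ : ∃ v c, w = v ++ [c] := by
          rcases List.eq_nil_or_concat w with h0 | ⟨v, c, h0⟩
          · exact (hwn h0).elim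
          · exact ⟨v, c, by simpa using h0⟩
        obtain ⟨m', hm', hm1', hm2'⟩ := hq' (e * ev g v) c ⟨v, [], rfl, rfl⟩
        obtain ⟨_, _, _, _, _, _, hf, hqf⟩ := id hF
        obtain ⟨_, _, _, _, _, _, hf', hqf'⟩ := id hF'
        have := absorbed_merge hg hL hf hqf hf' hqf' hm hm1 (hm2.trans (LeR.mul_right _ _))
          (n' := m' * g c) (by rw [← mul_assoc, hm']; simp [mul_assoc])
          ((LeR.mul_right _ _).trans hm1') hm2'
        rcases this with hh | hh
        · exact ⟨q, f, hF, hall ⟨m, hm, hm1, hm2⟩ fun z b hz => hh _ _ (hq' z b hz)⟩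
        · exact ⟨q', f', hF', hall (hh _ _ ⟨m, hm, hm1, hm2⟩) hq'⟩
  exact key u [] (by simp) hu

/-- The edge `q → q b` is a left translate of an edge inside an `R`-class that is not `J`-below
`x`. -/
def Translated (g : A → M) (x q : M) (b : A) : Prop :=
  ∃ c y, q = c * y ∧ LeR y (y * g b) ∧ ¬ LeJ y x

lemma occR_replicate {g : A → M} {u : List A} {e z : M} {b : A} (he : e * ev g u = e) (n : ℕ)
    (h : OccR g (List.replicate n u).flatten e b z) : OccR g u e b z := by
  induction n with
  | zero => obtain ⟨v, v', h, -⟩ := h; simp at h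
  | succ n ih =>
    rw [List.replicate_succ, List.flatten_cons, occR_append, he] at h
    exact h.elim id ih

lemma ev_replicate (g : A → M) (u : List A) (n : ℕ) :
    ev g (List.replicate n u).flatten = ev g u ^ n := by
  induction n with
  | zero => simp
  | succ n ih => rw [List.replicate_succ, List.flatten_cons, ev_append, ih, pow_succ']

/-- An unabsorbed translated edge at c y, with the J-ideal of y as small as possible, would let the
path be lifted backwards through u^K under translation by c. Then y would be J-below e, which
translatedness forbids. -/
lemma exists_factor_absorbing_edge [Finite M] {g : A → M} (hg : ∀ m, ∃ w, ev g w = m)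
    (hL : LCrossInv g) {u : List A} {e : M} {K : ℕ} (hK : ev g u ^ K = e) (he : e * ev g u = e)
    (h : ∀ z b, OccR g u e b z → ¬ Translated g e z b →
      ∃ q f, IdemFactor g u e q f ∧ Absorbed g q f z b) :
    ∀ z b, OccR g u e b z → ∃ q f, IdemFactor g u e q f ∧ Absorbed g q f z b := by
  have main : ∀ n : ℕ, ∀ z b c y, Nat.card {m : M // LeJ m y} = n → OccR g u e b z →
      z = c * y → LeR y (y * g b) → ¬ LeJ y e →
      ∃ q f, IdemFactor g u e q f ∧ Absorbed g q f z b := by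
    intro n
    induction n using Nat.strong_induction_on with
    | _ n ih =>
    rintro z b c y hn ⟨u', u'', hu, rfl⟩ hz ⟨σ, hσ⟩ hy
    by_contra hno
    -- Y is a lift, under translation by c, of the vertex reached by π.
    have back : ∀ N : ℕ, ∀ w π, π ++ w = (List.replicate N u).flatten ++ u' →
        ∃ Y, LeR Y y ∧ Y * ev g w = y ∧ c * Y = e * ev g π := by
      intro N w
      induction w with
      | nil =>
        intro π hπ
        refine ⟨y, LeR.refl y, by simp, ?_⟩
        rw [List.append_nil] at hπ
        rw [hπ, ev_append, ev_replicate, ← hz, ← mul_assoc]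
        congr 1
        clear * - he
        induction N with
        | zero => simp
        | succ N ih => rw [pow_succ', ← mul_assoc, he, ← ih]
      | cons d w ihw =>
        intro π hπ
        obtain ⟨Y, ⟨ρ, hYy⟩, hYw, hcY⟩ := ihw (π ++ [d]) (by simpa using hπ)
        have hπd : c * Y = e * ev g π * g d := by rw [hcY]; simp [mul_assoc]
        have hocc : OccR g u e d (e * ev g π) := by
          have h1 : OccR g ((List.replicate (N + 1) u).flatten) e d (e * ev g π) := by
            refine ⟨π, w ++ b :: u'', ?_, rfl⟩
            rw [List.replicate_succ', List.flatten_append, List.flatten_singleton]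
            calc _ = ((List.replicate N u).flatten ++ u') ++ b :: u'' := by rw [hu]; simp
              _ = _ := by rw [← hπ]; simp
          exact occR_replicate he _ h1
        by_cases hab : ∃ q f, IdemFactor g u e q f ∧ Absorbed g q f (e * ev g π) d
        · obtain ⟨q, f₀, hF, m, hm, hm1, k, hk⟩ := hab
          obtain ⟨_, _, _, _, _, _, hf, hqf⟩ := id hF
          have fm : f₀ * m = m := by obtain ⟨x, rfl⟩ := hm1; rw [← mul_assoc, hf]
          set n' := m * g d with hn'
          have hkk : n' * (k * f₀) = f₀ := by rw [← mul_assoc, ← hk, hf]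
          have fn : f₀ * n' = n' := by rw [hn', ← mul_assoc, fm]
          have hqn : q * n' = c * Y := by rw [hn', ← mul_assoc, hm, hπd]
          have hnF : n' * (k * f₀ * n') = n' := by rw [← mul_assoc, hkk, fn]
          have hl : LeL (c * Y) (k * f₀ * n') := ⟨q * n', by rw [mul_assoc q, hnF, hqn]⟩
          rcases leL_total hg hL hl (LeL.mul_left c Y) with ⟨x, hx⟩ | ⟨x, hx⟩
          -- If the idempotent k f₀ n' is L-below Y, the factor absorbing the edge d absorbs the
          -- original edge too.
          · refine (hno ⟨q, f₀, hF, n' * ev g w, ?_, ?_, σ * ρ * (k * f₀), ?_⟩).elim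
            · rw [← mul_assoc, hqn, mul_assoc, hYw, hz]
            · exact ⟨n' * ev g w, by rw [← mul_assoc, fn]⟩
            · have h1 : n' = n' * ev g w * g b * (σ * ρ) := by
                calc n' = n' * (x * Y) := by rw [← hx, hnF]
                  _ = n' * x * (y * g b * σ * ρ) := by rw [← hσ, ← hYy]; simp [mul_assoc]
                  _ = n' * (x * Y) * ev g w * g b * (σ * ρ) := by
                    conv_lhs => rw [← hYw]
                    simp [mul_assoc]
                  _ = _ := by rw [← hx, hnF]
              rw [← mul_assoc, ← h1, hkk]
          -- Otherwise this idempotent fixes Y from the right, and the edge d lifts backwards.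
          · have hYF : Y * (k * f₀ * n') = Y := by
              rw [hx, mul_assoc, mul_assoc (k * f₀), hnF]
            refine ⟨Y * (k * f₀ * m), ?_, ?_, ?_⟩
            · exact ⟨ρ * (k * f₀ * m), by rw [hYy, mul_assoc]⟩
            · calc Y * (k * f₀ * m) * ev g (d :: w) = Y * (k * f₀ * n') * ev g w := by
                    rw [ev_cons, hn']; simp [mul_assoc]
                _ = y := by rw [hYF, hYw]
            · calc c * (Y * (k * f₀ * m)) = q * (n' * (k * f₀)) * m := by
                    rw [← mul_assoc, ← hqn]; simp [mul_assoc]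
                _ = e * ev g π := by rw [hkk, hqf, hm]
        · obtain ⟨c₂, y₂, hc₂, ⟨σ₂, hσ₂⟩, hy₂⟩ : Translated g e (e * ev g π) d := by
            by_contra hT
            exact hab (h _ _ hocc hT)
          have hcard : n ≤ Nat.card {m : M // LeJ m y₂} := by
            by_contra hlt
            exact hab (ih _ (not_le.1 hlt) _ _ c₂ y₂ rfl hocc hc₂ ⟨σ₂, hσ₂⟩ hy₂)
          -- In the opposite case the minimality of the ideal makes y and y₂ J-equivalent, and
          -- stability reverses the comparison.
          have hle : LeL Y (y₂ * g d) := by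
            rcases leL_total hg hL (t := c * Y) (LeL.mul_left c Y)
              ⟨c₂, by rw [hπd, hc₂, mul_assoc]⟩ with h1 | h1
            · exact h1
            · refine h1.symm_of_leJ ?_
              have h2 : LeJ y₂ y := by
                refine LeJ.trans ?_ (h1.leJ.trans (LeR.leJ ⟨ρ, hYy⟩))
                exact LeR.leJ ⟨σ₂, hσ₂⟩
              have h3 : LeJ y y₂ := by
                have hsub : {m : M | LeJ m y₂} ⊆ {m : M | LeJ m y} := fun m hm => hm.trans h2
                have heq := Set.eq_of_subset_of_ncard_le hsub
                  (hn.le.trans hcard) (Set.toFinite _)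
                exact heq.symm.subset (LeJ.refl y)
              exact (LeR.leJ ⟨ρ, hYy⟩).trans (h3.trans (LeR.leJ ⟨σ₂, hσ₂⟩))
          obtain ⟨x, hx⟩ := hle
          refine ⟨Y * σ₂, ?_, ?_, ?_⟩
          · exact ⟨ρ * σ₂, by rw [hYy, mul_assoc]⟩
          · calc Y * σ₂ * ev g (d :: w) = x * (y₂ * g d * σ₂) * g d * ev g w := by
                  rw [hx, ev_cons]; simp [mul_assoc]
              _ = y := by rw [← hσ₂, mul_assoc x, ← hx, hYw]
          · calc c * (Y * σ₂) = c₂ * (y₂ * g d * σ₂) := by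
                  rw [← mul_assoc, hπd, hc₂]; simp [mul_assoc]
              _ = _ := by rw [← hσ₂, hc₂]
    obtain ⟨Y, -, hY, -⟩ := back K ((List.replicate K u).flatten ++ u') [] (by simp)
    exact hy ⟨Y, ev g u', by rw [← hY, ev_append, ev_replicate, hK]; simp [mul_assoc]⟩
  intro z b hocc
  by_cases hT : Translated g e z b
  · obtain ⟨c, y, h1, h2, h3⟩ := hT
    exact main _ z b c y rfl hocc h1 h2 h3
  · exact h z b hocc hT

end FiniteMonoid

/-! ### Counting passes through edges of the Cayley graph. -/

section Counting

variable {A : Type*} {M : Type*} [Monoid M]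

open Classical in
/-- The number of edges of the path labelled `w` from `m` that satisfy `P`. -/
noncomputable def edgeCount (g : A → M) (P : M → A → Prop) : M → List A → ℕ
  | _, [] => 0
  | m, a :: w => (if P m a then 1 else 0) + edgeCount g P (m * g a) w

lemma edgeCount_append (g : A → M) (P : M → A → Prop) (v w : List A) :
    ∀ m, edgeCount g P m (v ++ w) = edgeCount g P m v + edgeCount g P (m * ev g v) w := by
  induction v with
  | nil => intro m; simp [edgeCount]
  | cons a v ih => intro m; simp [edgeCount, ih, mul_assoc, add_assoc]

lemma edgeCount_mul_left (g : A → M) (P : M → A → Prop) (α : M) (w : List A) :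
    ∀ m, edgeCount g P (α * m) w = edgeCount g (fun n a => P (α * n) a) m w := by
  induction w with
  | nil => intro m; rfl
  | cons a w ih => intro m; simp [edgeCount, mul_assoc, ih]

lemma edgeCount_add_not (g : A → M) (P Q : M → A → Prop) (w : List A) :
    ∀ m, edgeCount g P m w = edgeCount g (fun n a => P n a ∧ Q n a) m w +
      edgeCount g (fun n a => P n a ∧ ¬ Q n a) m w := by
  induction w with
  | nil => intro m; rfl
  | cons a w ih =>
    intro m
    simp only [edgeCount, ih]
    by_cases h1 : P m a <;> by_cases h2 : Q m a <;> simp [h1, h2] <;> omega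

lemma edgeCount_congr (g : A → M) {P Q : M → A → Prop} (w : List A) :
    ∀ m, (∀ n a, OccR g w m a n → (P n a ↔ Q n a)) → edgeCount g P m w = edgeCount g Q m w := by
  induction w with
  | nil => intro m _; rfl
  | cons a w ih =>
    intro m h
    simp only [edgeCount]
    have hm := h m a ⟨[], w, rfl, by simp⟩
    rw [ih (m * g a)]
    · by_cases hP : P m a
      · rw [if_pos hP, if_pos (hm.1 hP)]
      · rw [if_neg hP, if_neg (fun hQ => hP (hm.2 hQ))]
    · rintro n b ⟨v, v', rfl, rfl⟩
      exact h _ _ ⟨a :: v, v', rfl, by simp [mul_assoc]⟩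

lemma occR_cons (g : A → M) (a : A) (w : List A) (m : M) (b : A) (s : M) :
    OccR g (a :: w) m b s ↔ (s = m ∧ b = a) ∨ OccR g w (m * g a) b s := by
  constructor
  · rintro ⟨v, z, h, rfl⟩
    cases v with
    | nil => simp at h; simp [h]
    | cons c v =>
      simp only [List.cons_append, List.cons.injEq] at h
      obtain ⟨rfl, rfl⟩ := h
      exact Or.inr ⟨v, z, rfl, by simp [mul_assoc]⟩
  · rintro (⟨rfl, rfl⟩ | ⟨v, z, rfl, rfl⟩)
    · exact ⟨[], w, rfl, by simp⟩
    · exact ⟨a :: v, z, rfl, by simp [mul_assoc]⟩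

/-- Edges that descend strictly in the `R`-order are traversed at most once. -/
lemma edgeCount_eq_ncard [Finite A] [Finite M] (g : A → M) {P : M → A → Prop} (w : List A) :
    ∀ m, (∀ n a, P n a → ¬ LeR n (n * g a)) →
      edgeCount g P m w = {x : M × A | OccR g w m x.2 x.1 ∧ P x.1 x.2}.ncard := by
  induction w with
  | nil =>
    intro m _
    have : {x : M × A | OccR g [] m x.2 x.1 ∧ P x.1 x.2} = ∅ := by
      ext x
      simp [OccR]
    rw [this]; simp [edgeCount]
  | cons a w ih =>
    intro m h
    simp only [edgeCount]
    rw [ih (m * g a) h]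
    by_cases hP : P m a
    · have : {x : M × A | OccR g (a :: w) m x.2 x.1 ∧ P x.1 x.2} =
          insert (m, a) {x : M × A | OccR g w (m * g a) x.2 x.1 ∧ P x.1 x.2} := by
        ext ⟨n, b⟩
        simp only [Set.mem_ofPred_eq, occR_cons, Set.mem_insert_iff, Prod.mk.injEq]
        constructor
        · rintro ⟨h1 | h1, h2⟩
          · exact Or.inl h1
          · exact Or.inr ⟨h1, h2⟩
        · rintro (⟨rfl, rfl⟩ | h1)
          · exact ⟨Or.inl ⟨rfl, rfl⟩, hP⟩
          · exact ⟨Or.inr h1.1, h1.2⟩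
      rw [this, Set.ncard_insert_of_notMem _ (Set.toFinite _)]
      · simp [hP, add_comm]
      · rintro ⟨⟨v, z, -, hv⟩, -⟩
        exact h m a hP ⟨ev g v, hv.symm⟩
    · have : {x : M × A | OccR g (a :: w) m x.2 x.1 ∧ P x.1 x.2} =
          {x : M × A | OccR g w (m * g a) x.2 x.1 ∧ P x.1 x.2} := by
        ext ⟨n, b⟩
        simp only [Set.mem_ofPred_eq, occR_cons]
        constructor
        · rintro ⟨⟨rfl, rfl⟩ | h1, h2⟩
          · exact (hP h2).elim
          · exact ⟨h1, h2⟩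
        · rintro ⟨h1, h2⟩
          exact ⟨Or.inr h1, h2⟩
      rw [this]; simp [hP]

lemma edgeCount_eq_of_crossing [Finite A] [Finite M] {g : A → M} (hR : RCrossInv g)
    {P : M → A → Prop} {u v : List A} (huv : ev g u = ev g v)
    (h : ∀ n a, P n a → ¬ LeR n (n * g a)) : edgeCount g P 1 u = edgeCount g P 1 v := by
  rw [edgeCount_eq_ncard g u 1 h, edgeCount_eq_ncard g v 1 h]
  congr 1
  ext ⟨n, a⟩
  constructor
  · rintro ⟨h1, h2⟩
    exact ⟨hR u v huv a n (h n a h2) h1, h2⟩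
  · rintro ⟨h1, h2⟩
    exact ⟨hR v u huv.symm a n (h n a h2) h1, h2⟩

/-- How often a path traverses the edge `q → q b`. -/
noncomputable abbrev passes (g : A → M) (q : M) (b : A) : M → List A → ℕ :=
  edgeCount g fun n a => n = q ∧ a = b

/-- The numbers of passes through an edge that is not translated, for two words with the same
idempotent value. -/
lemma passes_exchange [Finite A] [Finite M] {g : A → M} (hR : RCrossInv g) {x q : M} {b : A}
    (hgood : ¬ Translated g x q b) {u v : List A} {f : M} (hf : f * f = f)
    (hu : ev g u = f) (hv : ev g v = f)
    (hx : LeJ x f) (α : M) :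
    passes g q b α u + passes g q b (α * f) v = passes g q b α v + passes g q b (α * f) u := by
  -- Strict descents, read from 1, are counted equally in u and v. At any other counted edge,
  -- untranslatedness makes the vertex R-equivalent to f, so starting at α or at α f is the same.
  set Z : M → A → Prop := fun n a => ¬ LeR n (n * g a) with hZ
  have split : ∀ w γ, passes g q b γ w =
      edgeCount g (fun n a => (γ * n = q ∧ a = b) ∧ Z n a) 1 w +
        edgeCount g (fun n a => (γ * n = q ∧ a = b) ∧ ¬ Z n a) 1 w := by
    intro w γ
    have h1 := edgeCount_mul_left g (fun n a => n = q ∧ a = b) γ w 1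
    rw [mul_one] at h1
    rw [passes, h1]
    exact edgeCount_add_not g _ Z w 1
  have rest : ∀ w, ev g w = f →
      edgeCount g (fun n a => (α * n = q ∧ a = b) ∧ ¬ Z n a) 1 w =
        edgeCount g (fun n a => (α * f * n = q ∧ a = b) ∧ ¬ Z n a) 1 w := by
    intro w hw
    apply edgeCount_congr
    rintro n a ⟨v, v', rfl, rfl⟩
    rw [one_mul]
    have key : ∀ c, ¬ Z (ev g v) a → c * ev g v = q → a = b → f * ev g v = ev g v := by
      intro c hz hc hab
      subst hab
      have hJ : LeJ (ev g v) x := by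
        by_contra hJ
        exact hgood ⟨c, ev g v, hc.symm, not_not.1 hz, hJ⟩
      have hle : LeR f (ev g v) := ⟨g a * ev g v', by rw [← hw]; simp⟩
      obtain ⟨k, hk⟩ := hle.symm_of_leJ (hJ.trans hx)
      rw [hk, ← mul_assoc, hf]
    constructor
    · rintro ⟨⟨h1, h2⟩, h3⟩
      exact ⟨⟨by rw [mul_assoc, key α h3 h1 h2, h1], h2⟩, h3⟩
    · rintro ⟨⟨h1, h2⟩, h3⟩
      exact ⟨⟨by rw [← h1, mul_assoc, key (α * f) h3 h1 h2], h2⟩, h3⟩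
  have cross : ∀ γ, edgeCount g (fun n a => (γ * n = q ∧ a = b) ∧ Z n a) 1 u =
      edgeCount g (fun n a => (γ * n = q ∧ a = b) ∧ Z n a) 1 v := fun γ =>
    edgeCount_eq_of_crossing hR (hu.trans hv.symm) fun n a h => h.2
  rw [split u α, split v (α * f), split v α, split u (α * f), rest u hu, rest v hv, cross, cross]
  omega

/-- The inequality is strict because n + 1 passes enclose n loops. -/
lemma exists_blocks (g : A → M) (q : M) (b : A) (u : List A) :
    ∀ n α, n < passes g q b α u → ∃ (v : List A) (B : List (List A)) (z : List A),
      u = v ++ B.flatten ++ b :: z ∧ B.length = n ∧ α * ev g v = q ∧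
        ∀ w ∈ B, (∃ w', w = b :: w') ∧ q * ev g w = q := by
  induction u with
  | nil => intro n α h; simp [passes, edgeCount] at h
  | cons a u ih =>
    intro n α h
    simp only [passes, edgeCount] at h
    by_cases hab : α = q ∧ a = b
    · obtain ⟨rfl, rfl⟩ := hab
      cases n with
      | zero => exact ⟨[], [], u, by simp⟩
      | succ n =>
        obtain ⟨v, B, z, rfl, hB, hv, hall⟩ := ih n (α * g a) (by
          rw [if_pos ⟨rfl, rfl⟩, add_comm] at h
          exact Nat.lt_of_add_lt_add_left h)
        refine ⟨[], (a :: v) :: B, z, by simp, by simp [hB], by simp, ?_⟩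
        intro w hw
        rcases List.mem_cons.1 hw with rfl | hw
        · exact ⟨⟨v, rfl⟩, by rw [ev_cons, ← mul_assoc, hv]⟩
        · exact hall w hw
    · rw [if_neg hab, zero_add] at h
      obtain ⟨v, B, z, rfl, hB, hv, hall⟩ := ih n (α * g a) h
      exact ⟨a :: v, B, z, by simp, hB, by rw [ev_cons, ← mul_assoc, hv], hall⟩

/-- The color of a pair of cut points is the value of the loops between them, and a monochromatic
triangle says that f f = f. Each loop starts with b, so f = f f leads from f b back to f: the edge
is absorbed with lift f. -/
lemma exists_factor_of_passes {g : A → M} {p : ℕ}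
    (hp : ∀ f : ℕ → ℕ → M, ∃ i j k, i < j ∧ j < k ∧ k < p ∧ f i j = f j k ∧ f i j = f i k)
    {q e : M} {b : A} {u : List A} (h : p ≤ passes g q b e u) :
    ∃ q' f, IdemFactor g u e q' f ∧ Absorbed g q' f q b := by
  have hp0 : 0 < p := by
    obtain ⟨i, j, k, -, -, h, -⟩ := hp fun _ _ => 1
    omega
  -- p - 1 loops have p cut points, matching the bound k < p.
  obtain ⟨v, B, z, rfl, hB, hv, hall⟩ := exists_blocks g q b u (p - 1) e (by omega)
  obtain ⟨i, j, k, hij, hjk, hk, h1, h2⟩ :=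
    hp fun i j => ev g (((B.drop i).take (j - i)).flatten)
  have hdrop : ∀ i j : ℕ, i ≤ j → B.drop i = (B.drop i).take (j - i) ++ B.drop j := by
    intro i j hij
    conv_lhs => rw [← List.take_append_drop (j - i) (B.drop i)]
    rw [List.drop_drop, Nat.add_sub_cancel' hij]
  have hret : ∀ C : List (List A), (∀ w ∈ C, w ∈ B) → q * ev g C.flatten = q := by
    intro C
    induction C with
    | nil => intro _; simp
    | cons w C ih =>
      intro hC
      rw [List.flatten_cons, ev_append, ← mul_assoc, (hall w (hC w (by simp))).2,
        ih fun w' hw' => hC w' (by simp [hw'])]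
  have hmem : ∀ w ∈ (B.drop i).take (j - i), w ∈ B := fun w hw =>
    List.mem_of_mem_drop (List.mem_of_mem_take hw)
  have hmul : ev g ((B.drop i).take (k - i)).flatten =
      ev g ((B.drop i).take (j - i)).flatten * ev g ((B.drop j).take (k - j)).flatten := by
    rw [← ev_append, ← List.flatten_append]
    congr 2
    conv_lhs => rw [hdrop i j hij.le]
    rw [List.take_append, List.take_take, List.length_take, List.length_drop]
    congr 2 <;> omega
  have hid : ev g ((B.drop i).take (j - i)).flatten * ev g ((B.drop i).take (j - i)).flatten =
      ev g ((B.drop i).take (j - i)).flatten := by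
    conv_lhs =>
      arg 2
      rw [h1]
    rw [← hmul]
    exact h2.symm
  have hne : ∃ w', ((B.drop i).take (j - i)).flatten = b :: w' := by
    obtain ⟨w, C, hw⟩ : ∃ w C, (B.drop i).take (j - i) = w :: C := by
      refine List.exists_cons_of_length_pos ?_
      rw [List.length_take, List.length_drop]
      omega
    obtain ⟨w', rfl⟩ := (hall w (hmem w (by rw [hw]; simp))).1
    exact ⟨w' ++ C.flatten, by rw [hw]; simp⟩
  have hq := hret _ hmem
  obtain ⟨w', hw'⟩ := hne
  refine ⟨q, _, ⟨v ++ (B.take i).flatten, ((B.drop i).take (j - i)).flatten,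
    (B.drop j).flatten ++ b :: z, ?_, ?_, rfl, hid, hq⟩, _, hq, LeR.refl _, ev g w', ?_⟩
  · conv_lhs => rw [← List.take_append_drop i B, hdrop i j hij.le]
    simp
  · rw [ev_append, ← mul_assoc, hv]
    exact hret _ fun w hw => List.mem_of_mem_take hw
  · conv_lhs => rw [← hid]
    conv_lhs =>
      arg 2
      rw [hw']
    simp [mul_assoc]

/-- A loop with many passes through each of its edges that is not translated has an idempotent
value. -/
theorem mul_self_of_passes [Finite M] {g : A → M} (hg : ∀ m, ∃ w, ev g w = m)
    (hL : LCrossInv g) {p : ℕ}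
    (hp : ∀ f : ℕ → ℕ → M, ∃ i j k, i < j ∧ j < k ∧ k < p ∧ f i j = f j k ∧ f i j = f i k)
    {u : List A} (hu : u ≠ []) {e : M} {K : ℕ} (hK : ev g u ^ K = e) (he : e * ev g u = e)
    (h : ∀ q b, ¬ Translated g e q b → p ∣ passes g q b e u) :
    ev g u * ev g u = ev g u := by
  obtain ⟨q, f, hF, habs⟩ := exists_absorbing_factor hg hL hu
    (exists_factor_absorbing_edge hg hL hK he (fun z b hz hT => by
      refine exists_factor_of_passes hp (Nat.le_of_dvd ?_ (h z b hT))
      obtain ⟨v, v', rfl, rfl⟩ := hz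
      rw [passes, edgeCount_append]
      simp only [edgeCount, and_self, if_true]
      omega))
  exact mul_self_of_absorbed hg hL he hF habs

end Counting

/-! ### Ramsey's theorem for pairs. -/

section Ramsey

/-- Among sufficiently many numbers there are many such that the color of a pair depends only on
its smaller element. -/
lemma exists_prehomogeneous (C : Type*) [Finite C] (m : ℕ) :
    ∃ N : ℕ, ∀ (f : ℕ → ℕ → C) (s : Finset ℕ), N ≤ s.card →
      ∃ t ⊆ s, t.card = m ∧ ∃ c : ℕ → C, ∀ a ∈ t, ∀ b ∈ t, a < b → f a b = c a := by
  classical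
  have := Fintype.ofFinite C
  induction m with
  | zero =>
    refine ⟨1, fun f s hs => ⟨∅, by simp, rfl, fun a => f a a, by simp⟩⟩
  | succ m ih =>
    obtain ⟨N, hN⟩ := ih
    refine ⟨Fintype.card C * N + 2, fun f s hs => ?_⟩
    have hne : s.Nonempty := Finset.card_pos.1 (by omega)
    set x := s.min' hne
    have hcard : (s.erase x).card = s.card - 1 := Finset.card_erase_of_mem (s.min'_mem hne)
    obtain ⟨c, -, hc⟩ := Finset.exists_lt_card_fiber_of_mul_lt_card_of_maps_to
      (s := s.erase x) (t := (Finset.univ : Finset C)) (f := fun b => f x b) (n := N)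
      (fun _ _ => Finset.mem_univ _) (by rw [hcard, Finset.card_univ]; omega)
    obtain ⟨t, hts, htm, d, hd⟩ := hN f _ hc.le
    have hxt : ∀ b ∈ t, x < b ∧ b ∈ s ∧ f x b = c := by
      intro b hb
      have h1 := Finset.mem_filter.1 (hts hb)
      have h2 := Finset.mem_erase.1 h1.1
      exact ⟨lt_of_le_of_ne (s.min'_le b h2.2) (Ne.symm h2.1), h2.2, h1.2⟩
    refine ⟨insert x t, ?_, ?_, fun a => if a = x then c else d a, ?_⟩
    · intro b hb
      rcases Finset.mem_insert.1 hb with rfl | hb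
      · exact s.min'_mem hne
      · exact (hxt b hb).2.1
    · rw [Finset.card_insert_of_notMem, htm]
      intro hx
      exact lt_irrefl _ (hxt x hx).1
    · intro a ha b hb hab
      rcases Finset.mem_insert.1 ha with rfl | ha
      · rcases Finset.mem_insert.1 hb with rfl | hb
        · exact (lt_irrefl _ hab).elim
        · simp only [if_true]
          exact (hxt b hb).2.2
      · rcases Finset.mem_insert.1 hb with rfl | hb
        · exact (lt_asymm hab (hxt a ha).1).elim
        · simp only [(hxt a ha).1.ne', if_false]
          exact hd a ha b hb hab

/-- Ramsey's theorem for pairs and monochromatic sets of size four. -/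
lemma exists_monochromatic (C : Type*) [Finite C] :
    ∃ N : ℕ, ∀ f : ℕ → ℕ → C, ∃ i j k l c, i < j ∧ j < k ∧ k < l ∧ l < N ∧
      f i j = c ∧ f i k = c ∧ f i l = c ∧ f j k = c ∧ f j l = c ∧ f k l = c := by
  classical
  have := Fintype.ofFinite C
  obtain ⟨N, hN⟩ := exists_prehomogeneous C (Fintype.card C * 3 + 1)
  refine ⟨N, fun f => ?_⟩
  obtain ⟨t, hts, htm, d, hd⟩ := hN f (Finset.range N) (by simp)
  obtain ⟨c, -, hc⟩ := Finset.exists_lt_card_fiber_of_mul_lt_card_of_maps_to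
      (s := t) (t := (Finset.univ : Finset C)) (f := d) (n := 3)
      (fun _ _ => Finset.mem_univ _) (by rw [htm, Finset.card_univ]; omega)
  set r := t.filter fun x => d x = c with hr
  let o := r.orderEmbOfCardLe (Nat.succ_le_of_lt hc)
  have ho : ∀ i, o i ∈ t ∧ d (o i) = c := fun i =>
    Finset.mem_filter.1 (r.orderEmbOfCardLe_mem (Nat.succ_le_of_lt hc) i)
  have hlt : ∀ i j, i < j → f (o i) (o j) = c := fun i j hij => by
    rw [hd _ (ho i).1 _ (ho j).1 (o.lt_iff_lt.2 hij), (ho i).2]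
  refine ⟨o 0, o 1, o 2, o 3, c, o.lt_iff_lt.2 (by decide), o.lt_iff_lt.2 (by decide),
    o.lt_iff_lt.2 (by decide), Finset.mem_range.1 (hts (ho 3).1), hlt _ _ (by decide),
    hlt _ _ (by decide), hlt _ _ (by decide), hlt _ _ (by decide), hlt _ _ (by decide),
    hlt _ _ (by decide)⟩

/-- A bound, in terms of the number of colors, for the existence of a monochromatic triangle. -/
lemma exists_ramsey_function : ∃ N : ℕ → ℕ, ∀ (C : Type*) [Finite C] (p : ℕ), N (Nat.card C) ≤ p →
    ∀ f : ℕ → ℕ → C, ∃ i j k, i < j ∧ j < k ∧ k < p ∧ f i j = f j k ∧ f i j = f i k := by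
  choose N hN using fun n : ℕ => exists_monochromatic (Fin n)
  refine ⟨N, fun C _ p hp f => ?_⟩
  let e := Finite.equivFin C
  obtain ⟨i, j, k, l, c, h1, h2, h3, h4, h5, h6, -, h7, -, -⟩ := hN _ fun i j => e (f i j)
  exact ⟨i, j, k, h1, h2, by omega, e.injective (h5.trans h7.symm), e.injective (h5.trans h6.symm)⟩

end Ramsey

/-! ### The congruence of a Mal'cev expansion by generators. -/

section Congruence

variable {A : Type*} {S : Type*} [Semigroup S]

/-- The instances of the identities of `V` in the inverse images of the idempotents. -/
def malcevRel (V : Variety) (φ : FreeSemigroup A →ₙ* S) (x y : FreeSemigroup A) : Prop :=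
  ∃ e, IsIdempotentElem e ∧ ∃ i ∈ V, ∃ σ : ℕ → FreeSemigroup A, (∀ n, φ (σ n) = e) ∧
    x = FreeSemigroup.lift σ i.1 ∧ y = FreeSemigroup.lift σ i.2

lemma map_lift_eq {φ : FreeSemigroup A →ₙ* S} {e : S} (he : IsIdempotentElem e)
    {σ : ℕ → FreeSemigroup A} (hσ : ∀ n, φ (σ n) = e) (w : FreeSemigroup ℕ) :
    φ (FreeSemigroup.lift σ w) = e := by
  induction w using FreeSemigroup.recOnMul with
  | ih1 n => simp [hσ]
  | ih2 n w h1 h2 => rw [map_mul, map_mul, h1, h2, he.eq]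

lemma map_eq_of_malcevRel {V : Variety} {φ : FreeSemigroup A →ₙ* S} {x y : FreeSemigroup A}
    (h : malcevRel V φ x y) : φ x = φ y := by
  obtain ⟨e, he, i, -, σ, hσ, rfl, rfl⟩ := h
  rw [map_lift_eq he hσ, map_lift_eq he hσ]

lemma map_eq_of_conGen {V : Variety} {φ : FreeSemigroup A →ₙ* S} {x y : FreeSemigroup A}
    (h : conGen (malcevRel V φ) x y) : φ x = φ y := by
  induction h with
  | of x y h => exact map_eq_of_malcevRel h
  | refl x => rfl
  | symm _ ih => exact ih.symm
  | trans _ _ h1 h2 => exact h1.trans h2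
  | mul _ _ h1 h2 => rw [map_mul, map_mul, h1, h2]

/-- The congruence of the Mal'cev expansion is generated by the instances of the identities. -/
lemma malcevCon_iff {V : Variety} {φ : FreeSemigroup A →ₙ* S} {x y : FreeSemigroup A} :
    malcevCon V φ x y ↔ conGen (malcevRel V φ) x y := by
  constructor
  · intro h
    let ψ : (conGen (malcevRel V φ)).Quotient →ₙ* S :=
      { toFun := fun q => Con.liftOn q φ fun _ _ h => map_eq_of_conGen h
        map_mul' := by
          intro a b
          induction a, b using Con.induction_on₂ with
          | _ a b => exact map_mul φ a b }
    -- The generated congruence is one of those intersected: an identity in one of its fibers lifts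
    -- to words, where it is a generator.
    refine h _ ⟨ψ, fun _ => rfl, ?_⟩
    intro e he i hi σ
    choose τ hτ using fun n => Quotient.exists_rep ((σ n).1)
    have hφ : ∀ n, φ (τ n) = e := by
      intro n
      have h1 : ψ (σ n).1 = e := (σ n).2
      rw [← hτ n] at h1
      exact h1
    have hlift : ∀ w : FreeSemigroup ℕ, ((FreeSemigroup.lift σ w).1 :
        (conGen (malcevRel V φ)).Quotient) = ((FreeSemigroup.lift τ w : FreeSemigroup A) : _) := by
      intro w
      induction w using FreeSemigroup.recOnMul with
      | ih1 n =>
        rw [FreeSemigroup.lift_of, FreeSemigroup.lift_of]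
        exact (hτ n).symm
      | ih2 n w h1 h2 =>
        rw [map_mul, map_mul, MulMemClass.coe_mul, h1, h2]
        rfl
    apply Subtype.ext
    rw [hlift, hlift]
    exact (Con.eq _).2 (ConGen.Rel.of _ _ ⟨e, he, i, hi, τ, hφ, rfl, rfl⟩)
  · intro h
    refine (Con.conGen_le (c := malcevCon V φ)).2 ?_ h
    rintro x y ⟨e, he, i, hi, σ, hσ, rfl, rfl⟩ c ⟨ψ, hψ, hV⟩
    let τ : ℕ → fiber ψ e he := fun n => ⟨(σ n : c.Quotient), by
      show ψ _ = e
      rw [hψ, hσ]⟩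
    have hlift : ∀ w : FreeSemigroup ℕ, ((FreeSemigroup.lift τ w).1 : c.Quotient) =
        ((FreeSemigroup.lift σ w : FreeSemigroup A) : c.Quotient) := by
      intro w
      induction w using FreeSemigroup.recOnMul with
      | ih1 n => simp [τ]
      | ih2 n w h1 h2 =>
        rw [map_mul, map_mul, MulMemClass.coe_mul, h1, h2]
        rfl
    have := congrArg Subtype.val (hV e he i hi τ)
    rw [hlift, hlift] at this
    exact (Con.eq _).1 this

lemma toExpansion_eq_iff {V : Variety} {φ : FreeSemigroup A →ₙ* S} {x y : FreeSemigroup A} :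
    toExpansion V φ x = toExpansion V φ y ↔ conGen (malcevRel V φ) x y :=
  (Con.eq _).trans malcevCon_iff

lemma toExpansion_surjective (V : Variety) (φ : FreeSemigroup A →ₙ* S) :
    Function.Surjective (toExpansion V φ) := fun t => Quotient.exists_rep t

lemma map_eq_of_toExpansion_eq {V : Variety} {φ : FreeSemigroup A →ₙ* S} {x y : FreeSemigroup A}
    (h : toExpansion V φ x = toExpansion V φ y) : φ x = φ y :=
  map_eq_of_conGen (toExpansion_eq_iff.1 h)

lemma toExpansion_RB_mul_self {φ : FreeSemigroup A →ₙ* S} {e : S} (he : IsIdempotentElem e)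
    {u : FreeSemigroup A} (hu : φ u = e) :
    toExpansion RB φ (u * u) = toExpansion RB φ u :=
  toExpansion_eq_iff.2 (ConGen.Rel.of _ _ ⟨e, he, (X 0 * X 0, X 0), by simp [RB], fun _ => u,
    fun _ => hu, by simp, by simp⟩)

lemma toExpansion_RB_middle {φ : FreeSemigroup A →ₙ* S} {e : S} (he : IsIdempotentElem e)
    {u v z w : FreeSemigroup A} (hu : φ u = e) (hv : φ v = e) (hz : φ z = e) (hw : φ w = e) :
    toExpansion RB φ (u * z * v) = toExpansion RB φ (u * w * v) :=
  toExpansion_eq_iff.2 (ConGen.Rel.of _ _ ⟨e, he, (X 0 * X 2 * X 1, X 0 * X 3 * X 1),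
    by simp [RB], fun n => if n = 0 then u else if n = 1 then v else if n = 2 then z else w,
    fun n => by dsimp only; split_ifs <;> assumption, by simp, by simp⟩)

/-- In a rectangular band, `u z u = u`. -/
lemma toExpansion_RB_sandwich {φ : FreeSemigroup A →ₙ* S} {e : S} (he : IsIdempotentElem e)
    {u z : FreeSemigroup A} (hu : φ u = e) (hz : φ z = e) :
    toExpansion RB φ (u * z * u) = toExpansion RB φ u := by
  rw [toExpansion_RB_middle he hu hu hz hu, map_mul, toExpansion_RB_mul_self he hu, ← map_mul,
    toExpansion_RB_mul_self he hu]

lemma lift_iterate (σ : ℕ → FreeSemigroup A) (p : ℕ) :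
    FreeSemigroup.lift σ ((fun z => X 0 * z)^[p] (X 1)) = (fun z => σ 0 * z)^[p] (σ 1) := by
  induction p with
  | zero => simp
  | succ p ih => rw [Function.iterate_succ_apply', Function.iterate_succ_apply', map_mul, ih]; simp

lemma toExpansion_Zp_iterate {p : ℕ} {φ : FreeSemigroup A →ₙ* S} {e : S} (he : IsIdempotentElem e)
    {u v : FreeSemigroup A} (hu : φ u = e) (hv : φ v = e) :
    toExpansion (Zp p) φ ((fun z => u * z)^[p] v) = toExpansion (Zp p) φ v :=
  toExpansion_eq_iff.2 (ConGen.Rel.of _ _ ⟨e, he, ((fun z => X 0 * z)^[p] (X 1), X 1),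
    by simp [Zp], fun n => if n = 0 then u else v, fun n => by dsimp only; split_ifs <;> assumption,
    by rw [lift_iterate]; simp, by simp⟩)

end Congruence

/-! ### Words as lists, with values in a monoid with adjoined identity. -/

section Adjoin

variable {A : Type*} {B : Type*} [Semigroup B]

/-- An element of the free semigroup as a nonempty list of letters. -/
def toWord (w : FreeSemigroup A) : List A := w.head :: w.tail

@[simp] lemma toWord_mul (v w : FreeSemigroup A) : toWord (v * w) = toWord v ++ toWord w := rfl

/-- The values of the letters in `B` with an identity adjoined. -/
def letter (φ : FreeSemigroup A →ₙ* B) (a : A) : WithOne B := (φ (FreeSemigroup.of a) : B)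

@[simp] lemma ev_toWord (φ : FreeSemigroup A →ₙ* B) (w : FreeSemigroup A) :
    ev (letter φ) (toWord w) = (φ w : B) := by
  induction w using FreeSemigroup.recOnMul with
  | ih1 a => simp [toWord, letter]
  | ih2 a w h1 h2 => rw [toWord_mul, ev_append, h1, h2, map_mul, WithOne.coe_mul]

lemma eq_nil_or_toWord (l : List A) : l = [] ∨ ∃ w, toWord w = l := by
  cases l with
  | nil => exact Or.inl rfl
  | cons a l => exact Or.inr ⟨⟨a, l⟩, rfl⟩

lemma ev_letter_surjective {φ : FreeSemigroup A →ₙ* B} (hφ : Function.Surjective φ) (m : WithOne B) :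
    ∃ w, ev (letter φ) w = m := by
  rcases eq_or_ne m 1 with rfl | hm
  · exact ⟨[], rfl⟩
  · obtain ⟨b, rfl⟩ := WithOne.ne_one_iff_exists.1 hm
    obtain ⟨w, rfl⟩ := hφ b
    exact ⟨toWord w, ev_toWord φ w⟩

/-- The adjoined identity is the value of the empty word only. -/
lemma ev_letter_eq {φ : FreeSemigroup A →ₙ* B} {l l' : List A}
    (h : ev (letter φ) l = ev (letter φ) l') :
    l = l' ∨ ∃ w w', l = toWord w ∧ l' = toWord w' ∧ φ w = φ w' := by
  rcases eq_nil_or_toWord l with rfl | ⟨w, rfl⟩ <;> rcases eq_nil_or_toWord l' with rfl | ⟨w', rfl⟩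
  · exact Or.inl rfl
  · rw [ev_toWord, ev_nil] at h
    exact (WithOne.coe_ne_one h.symm).elim
  · rw [ev_toWord, ev_nil] at h
    exact (WithOne.coe_ne_one h).elim
  · rw [ev_toWord, ev_toWord, WithOne.coe_inj] at h
    exact Or.inr ⟨w, w', rfl, rfl, h⟩

end Adjoin

/-! ### Strict descents are invariants of expansions by rectangular bands. -/

section Crossings

variable {A : Type*} {S : Type*} [Semigroup S]

/-- An arbitrary start β lets the induction pass through products. In a generator, all that precedes
the last variable is a path that returns by u z u = u, so it contains no strict descent. -/
lemma occL_iff_of_conGen {φ : FreeSemigroup A →ₙ* S} {x y : FreeSemigroup A}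
    (h : conGen (malcevRel RB φ) x y) : ∀ (β : WithOne (MalcevExpansion RB φ)) b s,
      ¬ LeL s (letter (toExpansion RB φ) b * s) →
      (OccL (letter (toExpansion RB φ)) (toWord x) β b s ↔
        OccL (letter (toExpansion RB φ)) (toWord y) β b s) := by
  induction h with
  | of x y h =>
    intro β b s hs
    obtain ⟨e, he, i, hi, σ, hσ, rfl, rfl⟩ := h
    have ret : ∀ w v : FreeSemigroup A, φ w = e → φ v = e →
        ¬ OccL (letter (toExpansion RB φ)) (toWord w)
          (ev (letter (toExpansion RB φ)) (toWord v) * β) b s := by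
      intro w v hw hv hocc
      refine hs (hocc.leL_of_return ⟨(toExpansion RB φ v : MalcevExpansion RB φ), ?_⟩)
      simp only [ev_toWord, ← mul_assoc, ← WithOne.coe_mul, ← map_mul]
      rw [toExpansion_RB_sandwich he hv hw]
    rcases hi with rfl | rfl
    · simp only [map_mul, FreeSemigroup.lift_of, toWord_mul, occL_append]
      exact ⟨fun h => h.resolve_right (ret _ _ (hσ 0) (hσ 0)), Or.inl⟩
    · have h2 : ∀ z : FreeSemigroup A, φ z = e → (OccL (letter (toExpansion RB φ))
          (toWord (σ 0 * z * σ 1)) β b s ↔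
            OccL (letter (toExpansion RB φ)) (toWord (σ 1)) β b s) := by
        intro z hz
        rw [toWord_mul, occL_append]
        exact ⟨fun h => h.resolve_right (ret _ _ (by rw [map_mul, hσ, hz, he.eq]) (hσ 1)), Or.inl⟩
      simp only [map_mul, FreeSemigroup.lift_of]
      rw [h2 _ (hσ 2), h2 _ (hσ 3)]
  | refl x => intros; rfl
  | symm _ ih => intro β b s hs; exact (ih β b s hs).symm
  | trans _ _ h1 h2 => intro β b s hs; exact (h1 β b s hs).trans (h2 β b s hs)
  | mul _ hyz h1 h2 =>
    intro β b s hs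
    rw [toWord_mul, toWord_mul, occL_append, occL_append, h2 β b s hs, ev_toWord, ev_toWord,
      toExpansion_eq_iff.2 hyz, h1 _ b s hs]

lemma occR_iff_of_conGen {φ : FreeSemigroup A →ₙ* S} {x y : FreeSemigroup A}
    (h : conGen (malcevRel RB φ) x y) : ∀ (α : WithOne (MalcevExpansion RB φ)) b s,
      ¬ LeR s (s * letter (toExpansion RB φ) b) →
      (OccR (letter (toExpansion RB φ)) (toWord x) α b s ↔
        OccR (letter (toExpansion RB φ)) (toWord y) α b s) := by
  induction h with
  | of x y h =>
    intro α b s hs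
    obtain ⟨e, he, i, hi, σ, hσ, rfl, rfl⟩ := h
    have ret : ∀ w v : FreeSemigroup A, φ w = e → φ v = e →
        ¬ OccR (letter (toExpansion RB φ)) (toWord w)
          (α * ev (letter (toExpansion RB φ)) (toWord v)) b s := by
      intro w v hw hv hocc
      refine hs (hocc.leR_of_return ⟨(toExpansion RB φ v : MalcevExpansion RB φ), ?_⟩)
      simp only [ev_toWord, mul_assoc, ← WithOne.coe_mul, ← map_mul]
      rw [← mul_assoc v, toExpansion_RB_sandwich he hv hw]
    rcases hi with rfl | rfl
    · simp only [map_mul, FreeSemigroup.lift_of, toWord_mul, occR_append]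
      exact ⟨fun h => h.resolve_right (ret _ _ (hσ 0) (hσ 0)), Or.inl⟩
    · have h2 : ∀ z : FreeSemigroup A, φ z = e → (OccR (letter (toExpansion RB φ))
          (toWord (σ 0 * z * σ 1)) α b s ↔
            OccR (letter (toExpansion RB φ)) (toWord (σ 0)) α b s) := by
        intro z hz
        rw [mul_assoc, toWord_mul, occR_append]
        exact ⟨fun h => h.resolve_right (ret _ _ (by rw [map_mul, hσ, hz, he.eq]) (hσ 0)), Or.inl⟩
      simp only [map_mul, FreeSemigroup.lift_of]
      rw [h2 _ (hσ 2), h2 _ (hσ 3)]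
  | refl x => intros; rfl
  | symm _ ih => intro α b s hs; exact (ih α b s hs).symm
  | trans _ _ h1 h2 => intro α b s hs; exact (h1 α b s hs).trans (h2 α b s hs)
  | mul hwx _ h1 h2 =>
    intro α b s hs
    rw [toWord_mul, toWord_mul, occR_append, occR_append, h1 α b s hs, ev_toWord, ev_toWord,
      toExpansion_eq_iff.2 hwx, h2 _ b s hs]

lemma lCrossInv_RB (φ : FreeSemigroup A →ₙ* S) : LCrossInv (letter (toExpansion RB φ)) := by
  intro w w' h b s hs hocc
  rcases ev_letter_eq h with rfl | ⟨w, w', rfl, rfl, h'⟩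
  · exact hocc
  · exact (occL_iff_of_conGen (toExpansion_eq_iff.1 h') 1 b s hs).1 hocc

lemma rCrossInv_RB (φ : FreeSemigroup A →ₙ* S) : RCrossInv (letter (toExpansion RB φ)) := by
  intro w w' h b s hs hocc
  rcases ev_letter_eq h with rfl | ⟨w, w', rfl, rfl, h'⟩
  · exact hocc
  · exact (occR_iff_of_conGen (toExpansion_eq_iff.1 h') 1 b s hs).1 hocc

end Crossings

/-! ### Pass counts modulo p in the Z_p-expansion; finiteness of the RB-expansion. -/

section Passes

variable {A : Type*} {S : Type*} [Semigroup S]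

lemma passes_iterate (g : A → WithOne S) (q : WithOne S) (b : A) {γ : WithOne S}
    {u v : FreeSemigroup A} (hγ : γ * ev g (toWord u) = γ) (n : ℕ) :
    passes g q b γ (toWord ((fun z => u * z)^[n] v)) =
      n * passes g q b γ (toWord u) + passes g q b γ (toWord v) := by
  induction n with
  | zero => simp
  | succ n ih =>
    simp only [passes] at ih ⊢
    rw [Function.iterate_succ_apply', toWord_mul, edgeCount_append, hγ, ih]
    ring

/-- The J-condition is inherited by factors and gives `passes_exchange` its hypothesis.
Commutativity is that exchange; for x^p y = y it moves the start to α f, where x is a loop whose p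
copies count 0 modulo p. -/
lemma passes_eq_of_conGen [Finite A] [Finite S] {φ : FreeSemigroup A →ₙ* S}
    (hR : RCrossInv (letter φ)) {p : ℕ} {e q : WithOne S} {b : A}
    (hgood : ¬ Translated (letter φ) e q b) {x y : FreeSemigroup A}
    (h : conGen (malcevRel (Zp p) φ) x y) : LeJ e (φ x : WithOne S) → ∀ α : WithOne S,
      (passes (letter φ) q b α (toWord x) : ZMod p) = passes (letter φ) q b α (toWord y) := by
  have hfin : Finite (WithOne S) := inferInstanceAs (Finite (Option S))
  induction h with
  | of x y h =>
    intro hx α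
    have hxy := map_eq_of_malcevRel h
    obtain ⟨f, hf, i, hi, σ, hσ, rfl, rfl⟩ := h
    have hff : (f : WithOne S) * f = f := by rw [← WithOne.coe_mul, hf.eq]
    rw [map_lift_eq hf hσ] at hx
    have exch : ∀ u v : FreeSemigroup A, φ u = f → φ v = f →
        passes (letter φ) q b α (toWord u) + passes (letter φ) q b (α * f) (toWord v) =
          passes (letter φ) q b α (toWord v) + passes (letter φ) q b (α * f) (toWord u) :=
      fun u v hu hv => passes_exchange hR hgood hff (by rw [ev_toWord, hu])
        (by rw [ev_toWord, hv]) hx α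
    rcases hi with rfl | rfl
    · have h1 := exch (σ 0) (σ 1) (hσ 0) (hσ 1)
      simp only [map_mul, FreeSemigroup.lift_of, toWord_mul, passes, edgeCount_append, ev_toWord, hσ]
      exact congrArg Nat.cast h1
    · have h1 := exch (FreeSemigroup.lift σ ((fun z => X 0 * z)^[p] (X 1))) (σ 1)
        (map_lift_eq hf hσ _) (hσ 1)
      have h2 := passes_iterate (letter φ) q b (γ := α * f) (u := σ 0) (v := σ 1)
        (by rw [ev_toWord, hσ, mul_assoc, hff]) p
      rw [← lift_iterate] at h2
      rw [h2] at h1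
      have h3 := congrArg (Nat.cast : ℕ → ZMod p) h1
      push_cast at h3
      rw [ZMod.natCast_self, zero_mul, zero_add] at h3
      simpa using add_right_cancel h3
  | refl x => intros; rfl
  | symm h ih =>
    intro hx α
    rw [← map_eq_of_conGen h] at hx
    exact (ih hx α).symm
  | trans h _ h1 h2 =>
    intro hx α
    refine (h1 hx α).trans (h2 ?_ α)
    rwa [map_eq_of_conGen h] at hx
  | mul hwx _ h1 h2 =>
    intro hx α
    rw [map_mul, WithOne.coe_mul] at hx
    simp only [toWord_mul, passes, edgeCount_append, ev_toWord, map_eq_of_conGen hwx, Nat.cast_add]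
    congr 1
    · exact h1 (hx.trans (LeR.mul_right _ _).leJ) α
    · exact h2 (hx.trans (LeL.mul_left _ _).leJ) _

/-- The expansion of a finite semigroup by rectangular bands is finite. -/
lemma finite_expansion_RB [Finite A] [Finite S] (φ : FreeSemigroup A →ₙ* S) :
    Finite (MalcevExpansion RB φ) := by
  have hfin : Finite (WithOne S) := inferInstanceAs (Finite (Option S))
  obtain ⟨N, hN⟩ := exists_monochromatic (WithOne S)
  have short : ∀ n (w : FreeSemigroup A), (toWord w).length = n →
      ∃ v : FreeSemigroup A, (toWord v).length < N + 1 ∧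
        toExpansion RB φ v = toExpansion RB φ w := by
    intro n
    induction n using Nat.strong_induction_on with
    | _ n ih =>
    intro w hw
    by_cases hlen : (toWord w).length < N + 1
    · exact ⟨w, hlen, rfl⟩
    -- Four cut points give three consecutive factors with one idempotent value. The middle one can
    -- be deleted: u₁ u₂ u₃ = u₁ u₁ u₃ = u₁ u₃.
    obtain ⟨i, j, k, l, c, hij, hjk, hkl, hl, h1, h2, -, h4, -, h6⟩ :=
      hN fun i j => ev (letter φ) (((toWord w).drop i).take (j - i))
    have seg : ∀ i j, i < j → j ≤ N → ∃ u : FreeSemigroup A,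
        toWord u = ((toWord w).drop i).take (j - i) := by
      intro i j hij hj
      refine (eq_nil_or_toWord _).resolve_left ?_
      intro h
      have := congrArg List.length h
      rw [List.length_take, List.length_drop, List.length_nil] at this
      omega
    have hdrop : ∀ i j, i ≤ j →
        (toWord w).drop i = ((toWord w).drop i).take (j - i) ++ (toWord w).drop j := by
      intro i j hij
      conv_lhs => rw [← List.take_append_drop (j - i) ((toWord w).drop i)]
      rw [List.drop_drop, Nat.add_sub_cancel' hij]
    obtain ⟨u₁, hu₁⟩ := seg i j hij (by omega)
    obtain ⟨u₂, hu₂⟩ := seg j k hjk (by omega)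
    obtain ⟨u₃, hu₃⟩ := seg k l hkl (by omega)
    obtain ⟨u, hu⟩ := seg i k (hij.trans hjk) (by omega)
    have hu12 : u = u₁ * u₂ := by
      have : toWord u = toWord (u₁ * u₂) := by
        rw [toWord_mul, hu, hu₁, hu₂]
        conv_lhs => rw [hdrop i j hij.le]
        rw [List.take_append, List.take_take, List.length_take, List.length_drop]
        congr 2 <;> omega
      simp only [toWord, List.cons.injEq] at this
      exact FreeSemigroup.ext this.1 this.2
    rw [← hu₁, ev_toWord] at h1
    rw [← hu, ev_toWord] at h2
    rw [← hu₂, ev_toWord] at h4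
    rw [← hu₃, ev_toWord] at h6
    have e2 : φ u₂ = φ u₁ := WithOne.coe_inj.1 (h4.trans h1.symm)
    have e3 : φ u₃ = φ u₁ := WithOne.coe_inj.1 (h6.trans h1.symm)
    have he : IsIdempotentElem (φ u₁) := by
      have := WithOne.coe_inj.1 (h2.trans h1.symm)
      rwa [hu12, map_mul, e2] at this
    have key : toExpansion RB φ (u₁ * u₂ * u₃) = toExpansion RB φ (u₁ * u₃) := by
      rw [toExpansion_RB_middle he rfl e3 e2 rfl, map_mul, toExpansion_RB_mul_self he rfl, ← map_mul]
    obtain ⟨L, R, hsplit⟩ : ∃ L R, toWord w = L ++ toWord (u₁ * u₂ * u₃) ++ R := by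
      refine ⟨(toWord w).take i, (toWord w).drop l, ?_⟩
      conv_lhs => rw [← List.take_append_drop i (toWord w), hdrop i j hij.le, hdrop j k hjk.le,
        hdrop k l hkl.le, ← hu₁, ← hu₂, ← hu₃]
      simp
    obtain ⟨v, hv⟩ : ∃ v, toWord v = L ++ toWord (u₁ * u₃) ++ R := by
      refine (eq_nil_or_toWord _).resolve_left ?_
      simp [toWord]
    have hvw : toExpansion RB φ v = toExpansion RB φ w := by
      rw [← WithOne.coe_inj, ← ev_toWord, ← ev_toWord, hv, hsplit]
      simp only [ev_append]
      rw [ev_toWord, ev_toWord, key]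
    have hlt : (toWord v).length < n := by
      rw [← hw, hv, hsplit]
      simp [toWord]
    obtain ⟨v', h1', h2'⟩ := ih _ hlt v rfl
    exact ⟨v', h1', h2'.trans hvw⟩
  have hfs : {v : FreeSemigroup A | (toWord v).length < N + 1}.Finite := by
    refine Set.Finite.of_finite_image (f := toWord) ((List.finite_length_lt A (N + 1)).subset ?_) ?_
    · rintro _ ⟨v, hv, rfl⟩
      exact hv
    · intro v _ w _ h
      simp only [toWord, List.cons.injEq] at h
      exact FreeSemigroup.ext h.1 h.2
  refine Set.finite_univ_iff.1 ((hfs.image (toExpansion RB φ)).subset ?_)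
  intro t _
  obtain ⟨w, rfl⟩ := toExpansion_surjective RB φ t
  obtain ⟨v, h1, h2⟩ := short _ w rfl
  exact ⟨v, h1, h2⟩

end Passes

/-! ### Powers of words. -/

section Power

variable {A : Type*}

/-- The word `u` repeated `n + 1` times. -/
def upow (u : FreeSemigroup A) (n : ℕ) : FreeSemigroup A := (fun z => u * z)^[n] u

lemma coe_map_iterate {B : Type*} [Semigroup B] (ψ : FreeSemigroup A →ₙ* B)
    (u v : FreeSemigroup A) (n : ℕ) :
    (ψ ((fun z => u * z)^[n] v) : WithOne B) = (ψ u : WithOne B) ^ n * (ψ v : WithOne B) := by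
  induction n with
  | zero => simp
  | succ n ih => rw [Function.iterate_succ_apply', map_mul, WithOne.coe_mul, ih, pow_succ', mul_assoc]

lemma coe_map_upow {B : Type*} [Semigroup B] (ψ : FreeSemigroup A →ₙ* B)
    (u : FreeSemigroup A) (n : ℕ) :
    (ψ (upow u n) : WithOne B) = (ψ u : WithOne B) ^ (n + 1) := by
  rw [upow, coe_map_iterate, pow_succ]

lemma upow_succ (u : FreeSemigroup A) (n : ℕ) : upow u (n + 1) = upow u n * u := by
  induction n with
  | zero => rfl
  | succ n ih =>
    rw [upow, Function.iterate_succ_apply', ← upow, ih, ← mul_assoc]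
    congr 1
    rw [← ih]
    exact (Function.iterate_succ_apply' _ _ _).symm

lemma pow_mul_pow_self {M : Type*} [Monoid M] {a : M} {p : ℕ} (h : a ^ p * a = a) (hp : 0 < p) :
    a ^ p * a ^ p = a ^ p := by
  obtain ⟨q, rfl⟩ := Nat.exists_eq_succ_of_ne_zero hp.ne'
  nth_rw 2 [Nat.succ_eq_add_one, pow_succ']
  rw [← mul_assoc, h, ← pow_succ']

lemma pow_mul_eq_self {M : Type*} [Monoid M] {a : M} {p : ℕ} (h : a ^ p * a = a) (k : ℕ) :
    a ^ (k * p) * a = a := by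
  induction k with
  | zero => simp
  | succ k ih => rw [Nat.succ_mul, pow_add, mul_assoc, h, ih]

end Power

/-! ### Right stabilizers consist of comparable idempotents. -/

section Stabilizer

/-- Any two elements of a right stabilizer of an expansion by rectangular bands are comparable,
provided that they are idempotent. -/
lemma mul_eq_left_or_of_stabilizer {A S : Type*} [Semigroup S] {φ : FreeSemigroup A →ₙ* S}
    {t r s : MalcevExpansion RB φ} (hr : t * r = t) (hs : t * s = t)
    (hrr : r * r = r) (hss : s * s = s) : r * s = r ∨ s * r = s := by
  have key : ∀ r s : MalcevExpansion RB φ, s * s = s →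
      LeL (r : WithOne (MalcevExpansion RB φ)) s → r * s = r := by
    rintro r s hss ⟨m, hm⟩
    rw [← WithOne.coe_inj, WithOne.coe_mul, hm, mul_assoc, ← WithOne.coe_mul, hss]
  rcases leL_total (ev_letter_surjective (toExpansion_surjective RB φ)) (lCrossInv_RB φ)
    (t := (t : WithOne (MalcevExpansion RB φ))) (r := r) (s := s)
    ⟨t, by rw [← WithOne.coe_mul, hr]⟩ ⟨t, by rw [← WithOne.coe_mul, hs]⟩ with h | h
  · exact Or.inl (key r s hss h)
  · exact Or.inr (key s r hrr h)

variable {A : Type*} [Finite A] {S : Type*} [Semigroup S] [Finite S] {φ : FreeSemigroup A →ₙ* S}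
  {p : ℕ}

/-- Right stabilizers of the iterated expansion consist of idempotents. -/
theorem mul_self_of_mem_stabilizer (hp : ∀ f : ℕ → ℕ → WithOne (MalcevExpansion RB φ),
      ∃ i j k, i < j ∧ j < k ∧ k < p ∧ f i j = f j k ∧ f i j = f i k)
    {w u : FreeSemigroup A}
    (h : toExpansion RB (toExpansion (Zp p) (toExpansion RB φ)) (w * u) =
      toExpansion RB (toExpansion (Zp p) (toExpansion RB φ)) w) :
    toExpansion RB (toExpansion (Zp p) (toExpansion RB φ)) (u * u) =
      toExpansion RB (toExpansion (Zp p) (toExpansion RB φ)) u := by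
  have hp0 : 0 < p := by
    obtain ⟨i, j, k, -, -, hk, -⟩ := hp fun _ _ => 1
    omega
  have hfin1 : Finite (MalcevExpansion RB φ) := finite_expansion_RB φ
  have hfin : Finite (WithOne (MalcevExpansion RB φ)) :=
    inferInstanceAs (Finite (Option (MalcevExpansion RB φ)))
  set φ₁ := toExpansion RB φ with hφ₁
  set φ₂ := toExpansion (Zp p) φ₁ with hφ₂
  set φ₃ := toExpansion RB φ₂ with hφ₃
  set r : WithOne (MalcevExpansion RB φ) :=
    ((φ₁ u : MalcevExpansion RB φ) : WithOne (MalcevExpansion RB φ)) with hr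
  obtain ⟨k, hk, hkk⟩ := exists_pow_mul_self r
  obtain ⟨k, rfl⟩ := Nat.exists_eq_succ_of_ne_zero hk.ne'
  -- the powers of `u` above an idempotent
  have hv : IsIdempotentElem (φ₁ (upow u k)) := by
    rw [IsIdempotentElem, ← WithOne.coe_inj, WithOne.coe_mul, coe_map_upow]
    exact hkk
  obtain ⟨n, hn⟩ : ∃ n, (k + 1) * p = n + 1 :=
    Nat.exists_eq_succ_of_ne_zero (Nat.mul_pos k.succ_pos hp0).ne'
  -- In the fiber over an idempotent, x^p y = y makes p-th powers idempotent.
  have hn2 : IsIdempotentElem (φ₂ (upow u n)) := by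
    have := toExpansion_Zp_iterate (p := p) hv rfl rfl
    rw [← WithOne.coe_inj, ← hφ₂, coe_map_iterate, coe_map_upow] at this
    rw [IsIdempotentElem, ← WithOne.coe_inj, WithOne.coe_mul, coe_map_upow, ← hn]
    rw [pow_mul]
    exact pow_mul_pow_self this hp0
  have hn3 : (φ₃ u : WithOne (MalcevExpansion RB φ₂)) ^ (n + 1) *
      (φ₃ u : WithOne (MalcevExpansion RB φ₂)) ^ (n + 1) =
      (φ₃ u : WithOne (MalcevExpansion RB φ₂)) ^ (n + 1) := by
    have := toExpansion_RB_mul_self hn2 rfl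
    rwa [← WithOne.coe_inj, map_mul, WithOne.coe_mul, ← hφ₃, coe_map_upow] at this
  set b : WithOne (MalcevExpansion RB φ₂) :=
    ((φ₃ u : MalcevExpansion RB φ₂) : WithOne (MalcevExpansion RB φ₂)) with hb
  have hnn : b ^ (n + 1 + (n + 1)) = b ^ (n + 1) := by rw [pow_add, hn3]
  have hwb : (φ₃ w : WithOne (MalcevExpansion RB φ₂)) * b = φ₃ w := by
    rw [hb, ← WithOne.coe_mul, ← map_mul, h]
  have hwb' : ∀ m, (φ₃ w : WithOne (MalcevExpansion RB φ₂)) * b ^ m = φ₃ w := by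
    intro m
    induction m with
    | zero => simp
    | succ m ih => rw [pow_succ, ← mul_assoc, ih, hwb]
  -- b^(n+2) lies in the subgroup with identity b^(n+1); its inverse there is b^(2n+1).
  have hap : b ^ (n + 1 + 1) = b ^ (n + 1) :=
    eq_one_of_mem_stabilizer (ev_letter_surjective (toExpansion_surjective RB φ₂)) (lCrossInv_RB φ₂)
      (h' := b ^ (n + 1 + n)) (hwb' _)
      (by rw [← pow_add, ← add_assoc, pow_succ, hnn, ← pow_succ])
      (by rw [← pow_add, add_right_comm, pow_succ, hnn, ← pow_succ])
      (by rw [← pow_add, show n + 1 + 1 + (n + 1 + n) = n + 1 + (n + 1) + (n + 1) by omega,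
          pow_add, hnn, hn3])
      (by rw [← pow_add, show n + 1 + n + (n + 1 + 1) = n + 1 + (n + 1) + (n + 1) by omega,
          pow_add, hnn, hn3])
      (by rw [← pow_add, ← add_assoc, pow_add, hnn, ← pow_add])
  have h3 : φ₃ (upow u (n + 1)) = φ₃ (upow u n) := by
    rw [← WithOne.coe_inj, coe_map_upow, coe_map_upow]
    exact hap
  have h2 : φ₂ (upow u (n + 1)) = φ₂ (upow u n) := map_eq_of_toExpansion_eq h3
  have h1 : φ₁ (upow u (n + 1)) = φ₁ (upow u n) := map_eq_of_toExpansion_eq h2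
  -- `u` takes each good edge a multiple of `p` times
  have hre : r ^ (n + 1) = r ^ (k + 1) := by
    rw [← hn, pow_mul]
    exact IsIdempotentElem.pow_eq (n := p) hkk hp0.ne'
  have he : r ^ (k + 1) * r = r ^ (k + 1) := by
    have := h1
    rwa [← WithOne.coe_inj, coe_map_upow, coe_map_upow, pow_succ, ← hr, hre] at this
  have hrr : ev (letter φ₁) (toWord u) * ev (letter φ₁) (toWord u) = ev (letter φ₁) (toWord u) := by
    refine mul_self_of_passes (ev_letter_surjective (toExpansion_surjective RB φ)) (lCrossInv_RB φ)
      hp (e := r ^ (k + 1)) (K := k + 1) (by simp [toWord]) (by rw [ev_toWord]) (by rwa [ev_toWord])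
      fun q b hqb => ?_
    -- In u^(n+2), compared with u^(n+1), the extra copy of u is read from e.
    have := passes_eq_of_conGen (rCrossInv_RB φ) hqb (toExpansion_eq_iff.1 h2)
      (by rw [coe_map_upow, pow_succ _ (n + 1), ← hr, hre, he]; exact .refl _) 1
    rw [upow_succ, toWord_mul, passes, edgeCount_append, ev_toWord, coe_map_upow, one_mul, ← hr,
      hre, Nat.cast_add] at this
    exact (ZMod.natCast_eq_zero_iff _ _).1 (add_eq_left.1 this)
  have hu1 : IsIdempotentElem (φ₁ u) := by
    rwa [ev_toWord, ← WithOne.coe_mul, WithOne.coe_inj] at hrr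
  have hu2 : IsIdempotentElem (φ₂ u) := by
    -- With a the value of u in S₂, this yields a^(n+2) = a; since a^(n+2) = a^(n+1), also a^(n+1) =
    -- a, and so a a = a.
    have hpa := toExpansion_Zp_iterate (p := p) hu1 rfl rfl
    rw [← WithOne.coe_inj, ← hφ₂, coe_map_iterate] at hpa
    have hna := h2
    rw [← WithOne.coe_inj, coe_map_upow, coe_map_upow] at hna
    have := pow_mul_eq_self hpa (k + 1)
    rw [hn] at this
    have ha := this
    rw [← pow_succ, hna] at ha
    rw [IsIdempotentElem, ← WithOne.coe_inj, WithOne.coe_mul]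
    rwa [ha] at this
  exact toExpansion_RB_mul_self hu2 rfl

end Stabilizer

/-! ### Bands whose elements form a chain. -/

section Band

variable {M : Type*} [Semigroup M]

lemma mul_eq_of_lLe {a b : M} (hb : b * b = b) (h : LLe a b) : a * b = a := by
  rcases h with rfl | ⟨x, rfl⟩
  · exact hb
  · rw [mul_assoc, hb]

lemma mul_eq_of_rLe {a b : M} (hb : b * b = b) (h : RLe a b) : b * a = a := by
  rcases h with rfl | ⟨x, rfl⟩
  · exact hb
  · rw [← mul_assoc, hb]

/-- R-equivalent idempotents satisfy b a = a and a b = b, so either a b = a or b a = b makes them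
equal. -/
lemma rTrivial_of_chain (hM : ∀ x : M, x * x = x) (hc : ∀ x y : M, x * y = x ∨ y * x = y) :
    RTrivial M := by
  intro a b hab hba
  have h1 := mul_eq_of_rLe (hM b) hab
  have h2 := mul_eq_of_rLe (hM a) hba
  rcases hc a b with h | h
  · rw [← h, h2]
  · rw [← h, h1]

end Band

end SgpExpansion

theorem mainTheorem8 :
    ∃ N : ℕ → ℕ, ∀ (A : Type*) [Finite A] (S : Type*) [Semigroup S] [Finite S]
      (φ : FreeSemigroup A →ₙ* S), Function.Surjective φ →
      ∀ p : ℕ, p.Prime →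
        N (Nat.card (SgpExpansion.MalcevExpansion SgpExpansion.RB φ)) ≤ p →
      ∀ t : SgpExpansion.MalcevExpansion SgpExpansion.RB
          (SgpExpansion.toExpansion (SgpExpansion.Zp p)
            (SgpExpansion.toExpansion SgpExpansion.RB φ)),
        -- the right stabilizer of `t` is an `R`-trivial, i.e. left regular, band
        (∀ x : SgpExpansion.rightStabilizer t, x * x = x) ∧
        SgpExpansion.RTrivial (SgpExpansion.rightStabilizer t) ∧
        (∀ x y : SgpExpansion.rightStabilizer t, x * y * x = x * y) ∧
        -- it is a chain under its own `L`-order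
        (∀ r s : SgpExpansion.rightStabilizer t,
          SgpExpansion.LLe s r ∨ SgpExpansion.LLe r s) ∧
        -- `r ≥ s` in its `L`-order implies `s r = s`
        (∀ r s : SgpExpansion.rightStabilizer t, SgpExpansion.LLe s r → s * r = s) ∧
        -- its `L`-classes are left zero semigroups
        (∀ r : SgpExpansion.rightStabilizer t,
          ∀ x ∈ SgpExpansion.lClass r, ∀ y ∈ SgpExpansion.lClass r,
            x * y ∈ SgpExpansion.lClass r ∧ x * y = x) := by
  obtain ⟨N, hN⟩ := SgpExpansion.exists_ramsey_function
  -- The colors lie in S^RB with an identity adjoined, whence n + 1.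
  refine ⟨fun n => N (n + 1), fun A _ S _ _ φ _ p _ hp t => ?_⟩
  have hfin := SgpExpansion.finite_expansion_RB φ
  have hfin' : Finite (WithOne (SgpExpansion.MalcevExpansion SgpExpansion.RB φ)) :=
    inferInstanceAs (Finite (Option (SgpExpansion.MalcevExpansion SgpExpansion.RB φ)))
  have hcard : Nat.card (WithOne (SgpExpansion.MalcevExpansion SgpExpansion.RB φ)) =
      Nat.card (SgpExpansion.MalcevExpansion SgpExpansion.RB φ) + 1 :=
    Finite.card_option
  have hram := hN (WithOne (SgpExpansion.MalcevExpansion SgpExpansion.RB φ)) p (by rwa [hcard])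
  have hband : ∀ x : SgpExpansion.rightStabilizer t, x * x = x := by
    rintro ⟨x, hx⟩
    obtain ⟨w, rfl⟩ := SgpExpansion.toExpansion_surjective _ _ t
    obtain ⟨u, rfl⟩ := SgpExpansion.toExpansion_surjective _ _ x
    refine Subtype.ext ?_
    have := SgpExpansion.mul_self_of_mem_stabilizer hram (w := w) (u := u)
      ((map_mul _ _ _).trans hx)
    rwa [map_mul] at this
  have hchain : ∀ x y : SgpExpansion.rightStabilizer t, x * y = x ∨ y * x = y := fun x y =>
    (SgpExpansion.mul_eq_left_or_of_stabilizer x.2 y.2 (congrArg Subtype.val (hband x))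
      (congrArg Subtype.val (hband y))).imp (fun h => Subtype.ext h) (fun h => Subtype.ext h)
  have hR := SgpExpansion.rTrivial_of_chain hband hchain
  -- x y x = x y by R-triviality, since x y x y = x y.
  refine ⟨hband, hR, fun x y => hR _ _ (Or.inr ⟨x, rfl⟩) (Or.inr ⟨y, ?_⟩),
    fun r s => (hchain s r).imp (fun h => Or.inr ⟨s, h.symm⟩) (fun h => Or.inr ⟨r, h.symm⟩),
    fun r s h => SgpExpansion.mul_eq_of_lLe (hband r) h, fun r x hx y hy => ?_⟩
  · rw [mul_assoc, hband]
  · have hxr := SgpExpansion.mul_eq_of_lLe (hband r) hx.2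
    have hry := SgpExpansion.mul_eq_of_lLe (hband y) hy.1
    have hxy : x * y = x := by rw [← hxr, mul_assoc, hry]
    exact ⟨hxy.symm ▸ hx, hxy⟩
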